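/- Theorem 1.1. Let $(M,g)$ be a compact, connected, smooth Riemannian manifold of dimension $m$ without boundary, with volume density $|dV_g|$. Let $\boldsymbol V\subset C^\infty(M)$ be a vector subspace of finite dimension $N$ equipped with a Euclidean inner product $(-,-)$, and let $S(\boldsymbol V)$ be its unit sphere, with area density $|dS|$. Assume that $\boldsymbol V$ is ample: for every $x\in M$ the linear map $\boldsymbol V\ni v\mapsto d_xv\in T_x^*M$ is surjective. For $v\in\boldsymbol V$ let $\mu_M(v)\in\{0,1,2,\dots,\infty\}$ be the number of critical points of $v$ on $M$, and let $$\mu(M,\boldsymbol V):=\frac{1}{\mathrm{area}(S(\boldsymbol V))}\int_{S(\boldsymbol V)}\mu_M(v)\,|dS(v)|$$ be the expected number of critical points of a random function from $S(\boldsymbol V)$. For $x\in M$ let $K_x=\{v\in\boldsymbol V:\ d_xv=0\}$, a subspace of codimension $m$ with unit sphere $S(K_x)$, let $K_x^\perp$ be its orthogonal complement in $\boldsymbol V$, and let $\Xi_x:T_xM\otimes K_x^\perp\to K_x$ be the shape operator of the bundle $K^\perp\subset\boldsymbol V\times M$, i.e. the differential at $x$ of the Gauss map $y\mapsto K_y^\perp$: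 for a smooth section $u$ of $K^\perp$ and $X\in T_xM$, $\Xi_x(X,u(x))$ is the orthogonal projection onto $K_x$ of the derivative $D_Xu\in\boldsymbol V$ of $u: M\to\boldsymbol V$ along $X$. For $v\in K_x$ let $|\det\Xi_x\cdot v|$ be the absolute value of the determinant of the $m\times m$ matrix $\big(\,(\Xi_x(e_i,u_j),v)\,\big)_{i,j}$, where $(e_i)$ is any $g$-orthonormal basis of $T_xM$ and $(u_j)$ is any orthonormal basis of $K_x^\perp$ (it does not depend on the bases). Then $\mu_M$ and $x\mapsto\int_{S(K_x)}|\det\Xi_x\cdot v|\,|dS(v)|$ are measurable up to null sets, $\mu(M,\boldsymbol V)$ is finite, and $$\mu(M,\boldsymbol V)=\frac{1}{\boldsymbol\sigma_{N-1}}\int_M\Big(\int_{S(K_x)}|\det\Xi_x\cdot v|\,|dS(v)|\Big)|dV_g(x)|,$$ where $\boldsymbol\sigma_{N-1}$ is the area of the unit sphere $S^{N-1}\subset\mathbb R^N$. -/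

import Mathlib

open MeasureTheory Metric Set Bundle Manifold ContDiff
open scoped ENNReal InnerProductSpace

noncomputable section

/-- The area measure on the unit sphere `S(F)` of a Euclidean space `F`. -/
def sphereMeasure (F : Type*) [NormedAddCommGroup F] [InnerProductSpace ℝ F]
    [FiniteDimensional ℝ F] [MeasurableSpace F] [BorelSpace F] : Measure (sphere (0 : F) 1) :=
  (volume : Measure F).toSphere

/-- The area `σ_{n-1}` of the unit sphere `S^{n-1}` of `ℝ^n`. -/
def unitSphereArea (n : ℕ) : ℝ≥0∞ := sphereMeasure (EuclideanSpace ℝ (Fin n)) univ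

section Volume

variable {m : ℕ} {M : Type*} [TopologicalSpace M] [ChartedSpace (EuclideanSpace ℝ (Fin m)) M]
  [RiemannianBundle (fun x : M ↦ TangentSpace (𝓡 m) x)]

/-- The `i`-th coordinate vector field `∂_i` of the chart at `x₀`, at the point of `M` with
coordinates `y`. -/
def coordField (x₀ : M) (y : EuclideanSpace ℝ (Fin m)) (i : Fin m) :
    TangentSpace (𝓡 m) ((extChartAt (𝓡 m) x₀).symm y) :=
  mfderiv 𝓘(ℝ, EuclideanSpace ℝ (Fin m)) (𝓡 m) (extChartAt (𝓡 m) x₀).symm y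
    (EuclideanSpace.single i (1 : ℝ))

/-- The density `√(det g(∂_i, ∂_j))` of the Riemannian volume in the chart at `x₀`. -/
def volumeDensity (x₀ : M) (y : EuclideanSpace ℝ (Fin m)) : ℝ :=
  √(Matrix.gram ℝ (coordField x₀ y)).det

variable [MeasurableSpace M]

/-- The Riemannian volume on the domain of the chart at `x₀`, extended by zero. -/
def chartVolume (x₀ : M) : Measure M :=
  (((volume : Measure (EuclideanSpace ℝ (Fin m))).restrict
    (extChartAt (𝓡 m) x₀).target).withDensity
      (fun y ↦ ENNReal.ofReal (volumeDensity x₀ y))).map (extChartAt (𝓡 m) x₀).symm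

variable (m M) in
/-- The Riemannian volume: the smallest measure dominating `√(det g(∂_i, ∂_j)) dy` in each chart.
As those measures coincide on the overlaps of charts, it is the one that restricts to
`√(det g(∂_i, ∂_j)) dy` on the domain of each chart. -/
def riemannianVolume : Measure M := ⨆ x₀ : M, chartVolume (m := m) x₀

end Volume

section SampleSpace

variable {m : ℕ} {M : Type*} [TopologicalSpace M] [ChartedSpace (EuclideanSpace ℝ (Fin m)) M]

/-- A vector space `V` of smooth functions, with the Euclidean metric `h`. -/
def SampleSpace (V : Submodule ℝ C^∞⟮𝓡 m, M; ℝ⟯) (_h : InnerProductSpace.Core ℝ V) : Type _ := V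

namespace SampleSpace

variable (V : Submodule ℝ C^∞⟮𝓡 m, M; ℝ⟯) (h : InnerProductSpace.Core ℝ V)

instance : NormedAddCommGroup (SampleSpace V h) := h.toNormedAddCommGroup

instance : InnerProductSpace ℝ (SampleSpace V h) := InnerProductSpace.ofCore h.toCore

instance [FiniteDimensional ℝ V] : FiniteDimensional ℝ (SampleSpace V h) :=
  inferInstanceAs (FiniteDimensional ℝ V)

instance : MeasurableSpace (SampleSpace V h) := borel _

instance : BorelSpace (SampleSpace V h) := ⟨rfl⟩

/-- The inclusion `V ⊂ C^∞(M)`. -/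
def incl : SampleSpace V h →ₗ[ℝ] C^∞⟮𝓡 m, M; ℝ⟯ := V.subtype

end SampleSpace

end SampleSpace


section ShapeOperator

/- A linear family `ι : E → C^∞(M)` of smooth functions, parametrized by a Euclidean space `E`. It
is used for the inclusion of a space of smooth functions that carries a Euclidean metric. -/
variable {m : ℕ} {M : Type*} [TopologicalSpace M] [ChartedSpace (EuclideanSpace ℝ (Fin m)) M]
  {E : Type*} [NormedAddCommGroup E] [InnerProductSpace ℝ E]
  (ι : E →ₗ[ℝ] C^∞⟮𝓡 m, M; ℝ⟯)

/-- The adjunction map `A_x : E → T*_x M`, `v ↦ d_x v`. -/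
def adjunction (x : M) : E →ₗ[ℝ] (TangentSpace (𝓡 m) x →L[ℝ] ℝ) where
  toFun v := mvfderiv (𝓡 m) (ι v) x
  map_add' v w := by
    rw [map_add, ContMDiffMap.coe_add]
    exact mvfderiv_add ((ι v).contMDiff.mdifferentiable (by simp) x)
      ((ι w).contMDiff.mdifferentiable (by simp) x)
  map_smul' c v := by
    have h := mvfderiv_smul (x := x) (a := fun _ : M ↦ c) (I := 𝓡 m)
      (mdifferentiableAt_const) ((ι v).contMDiff.mdifferentiable (by simp) x)
    rw [map_smul, ContMDiffMap.coe_smul]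
    refine Eq.trans h ?_
    rw [mvfderiv_const]
    ext X
    simp

/-- Ampleness: every covector of `M` is the differential of a function of the family. -/
def IsAmple : Prop := ∀ x : M, Function.Surjective (adjunction ι x)

/-- The space `K_x` of the functions that are critical at `x`. -/
def criticalSpace (x : M) : Submodule ℝ E := (adjunction ι x).ker

/-- The number of critical points of `v`, in `{0, 1, 2, …, ∞}`. -/
def numCritical (v : E) : ℕ∞ := {x : M | v ∈ criticalSpace ι x}.encard

variable [FiniteDimensional ℝ E]

/-- The Gauss map `x ↦ K_x^⊥`, where a subspace of `E` is represented by the orthogonal projection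
onto it. -/
def gaussMap (x : M) : E →L[ℝ] E := (criticalSpace ι x)ᗮ.starProjection

/-- The shape operator `Ξ_x : T_x M × K_x^⊥ → K_x` of the bundle `K^⊥`, i.e. the differential of the
Gauss map: `Ξ_x(X, u)` is the component in `K_x` of the derivative along `X` of the section
`y ↦ gaussMap y u` of `K^⊥`, whose value at `x` is `u`. By `shapeOperator_section` any other section
of `K^⊥` through `u` gives the same result. -/
def shapeOperator (x : M) :
    TangentSpace (𝓡 m) x →ₗ[ℝ] (criticalSpace ι x)ᗮ →ₗ[ℝ] criticalSpace ι x :=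
  LinearMap.mk₂ ℝ
    (fun X u ↦ (criticalSpace ι x).orthogonalProjectionOnto
      (mvfderiv (𝓡 m) (gaussMap ι) x X (u : E)))
    (by intros; simp) (by intros; simp) (by intros; simp) (by intros; simp)


/-- The projection onto the orthogonal complement of a kernel, in terms of a map `T` onto it. -/
theorem starProjection_orthogonal_eq {F : Type*} [NormedAddCommGroup F] [NormedSpace ℝ F]
    [FiniteDimensional ℝ F] (K : Submodule ℝ E) (T : F →L[ℝ] E) (hT : Function.Injective T)
    (hK : ∀ v, v ∈ K ↔ ∀ w, ⟪v, T w⟫_ℝ = 0) :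
    (∃ e : F ≃L[ℝ] (F →L[ℝ] ℝ), (e : F →L[ℝ] (F →L[ℝ] ℝ)) =
      ((ContinuousLinearMap.compL ℝ F E ℝ).flip T ∘L innerSL ℝ) ∘L T) ∧
    Kᗮ.starProjection = T ∘L (((ContinuousLinearMap.compL ℝ F E ℝ).flip T ∘L innerSL ℝ) ∘L
      T).inverse ∘L ((ContinuousLinearMap.compL ℝ F E ℝ).flip T ∘L innerSL ℝ) := by
  set A : E →L[ℝ] (F →L[ℝ] ℝ) := (ContinuousLinearMap.compL ℝ F E ℝ).flip T ∘L innerSL ℝ with hA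
  have hAv : ∀ v w, A v w = ⟪v, T w⟫_ℝ := fun v w ↦ rfl
  have hinj : Function.Injective (A ∘L T) := by
    refine (injective_iff_map_eq_zero _).2 fun w hw ↦ hT ?_
    have := DFunLike.congr_fun hw w
    rw [map_zero, ← inner_self_eq_zero (𝕜 := ℝ), ← hAv]
    exact this
  have hfr : Module.finrank ℝ F = Module.finrank ℝ (F →L[ℝ] ℝ) := by
    have L : (F →ₗ[ℝ] ℝ) ≃ₗ[ℝ] (F →L[ℝ] ℝ) := LinearMap.toContinuousLinearMap
    rw [← L.finrank_eq]
    exact Subspace.dual_finrank_eq.symm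
  obtain ⟨e, he⟩ : ∃ e : F ≃L[ℝ] (F →L[ℝ] ℝ), (e : F →L[ℝ] (F →L[ℝ] ℝ)) = A ∘L T :=
    ⟨(LinearEquiv.ofInjectiveOfFinrankEq (A ∘L T).toLinearMap hinj hfr).toContinuousLinearEquiv,
      by ext; rfl⟩
  refine ⟨⟨e, he⟩, ?_⟩
  ext u
  rw [← he, ContinuousLinearMap.inverse_equiv]
  refine Submodule.eq_starProjection_of_mem_orthogonal ?_ ?_
  · exact (Submodule.mem_orthogonal _ _).2 fun v hv ↦ (hK v).1 hv _
  · rw [Submodule.orthogonal_orthogonal]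
    refine (hK _).2 fun w ↦ ?_
    have h1 : A (T (e.symm (A u))) = A u := by
      change (A ∘L T) _ = _
      rw [← he]
      simp
    have h2 : A (u - T (e.symm (A u))) = 0 := by rw [map_sub, h1, sub_self]
    rw [← hAv]
    exact DFunLike.congr_fun h2 w

variable {ι} [IsManifold (𝓡 m) ∞ M]

theorem IsAmple.mdifferentiableAt_gaussMap (hι : IsAmple ι) (x : M) :
    MDifferentiableAt (𝓡 m) 𝓘(ℝ, E →L[ℝ] E) (gaussMap ι) x := by
  set φ := extChartAt (𝓡 m) x with hφ
  have hopen : IsOpen φ.target := isOpen_extChartAt_target x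
  let b := stdOrthonormalBasis ℝ E
  let G : EuclideanSpace ℝ (Fin m) → E := fun z ↦ ∑ a, ι (b a) (φ.symm z) • b a
  have hf : ∀ v : E, ContDiffOn ℝ ∞ (fun z ↦ ι v (φ.symm z)) φ.target := fun v ↦
    contMDiffOn_iff_contDiffOn.1
      ((ι v).contMDiff.comp_contMDiffOn (contMDiffOn_extChartAt_symm x))
  have hG : ContDiffOn ℝ ∞ G φ.target :=
    ContDiffOn.sum fun a _ ↦ (hf (b a)).smul contDiffOn_const
  have hinner : ∀ (v : E) (z), ⟪v, G z⟫_ℝ = ι v (φ.symm z) := by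
    intro v z
    let l : E →ₗ[ℝ] ℝ :=
      { toFun := fun v ↦ ι v (φ.symm z)
        map_add' := fun v w ↦ by rw [map_add, ContMDiffMap.coe_add, Pi.add_apply]
        map_smul' := fun c v ↦ by rw [map_smul, ContMDiffMap.coe_smul, Pi.smul_apply]; rfl }
    change _ = l v
    conv_rhs => rw [← b.sum_repr' v]
    simp only [G, inner_sum, inner_smul_right, map_sum, map_smul]
    refine Finset.sum_congr rfl fun a _ ↦ ?_
    rw [smul_eq_mul, mul_comm, real_inner_comm]
    rfl
  have hT : ∀ z ∈ φ.target, ∀ v w, ⟪v, fderiv ℝ G z w⟫_ℝ = adjunction ι (φ.symm z) v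
      (mfderiv 𝓘(ℝ, EuclideanSpace ℝ (Fin m)) (𝓡 m) φ.symm z w) := by
    intro z hz v w
    have hGz : DifferentiableAt ℝ G z :=
      (hG.contDiffAt (hopen.mem_nhds hz)).differentiableAt (by simp)
    have h1 : fderiv ℝ (fun z ↦ ⟪v, G z⟫_ℝ) z w = ⟪v, fderiv ℝ G z w⟫_ℝ := by
      have := ((innerSL ℝ v).hasFDerivAt.comp z hGz.hasFDerivAt).fderiv
      exact DFunLike.congr_fun this w
    rw [← h1]
    simp only [hinner]
    have h2 := mvfderiv_comp_apply z ((ι v).contMDiff.mdifferentiable (by simp) (φ.symm z))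
      (((contMDiffOn_extChartAt_symm (I := 𝓡 m) (n := ∞) x).contMDiffAt
        (hopen.mem_nhds hz)).mdifferentiableAt (by simp)) w
    refine Eq.trans ?_ h2
    rw [mvfderiv, mfderiv_eq_fderiv]
    rfl
  have hsurj : ∀ z ∈ φ.target, Function.Bijective
      (mfderiv 𝓘(ℝ, EuclideanSpace ℝ (Fin m)) (𝓡 m) φ.symm z) := by
    intro z hz
    have := isInvertible_mfderivWithin_extChartAt_symm (I := 𝓡 m) hz
    rw [ModelWithCorners.range_eq_univ, mfderivWithin_univ] at this
    exact this.bijective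
  have hTinj : ∀ z ∈ φ.target, Function.Injective (fderiv ℝ G z) := by
    intro z hz
    refine (injective_iff_map_eq_zero _).2 fun w hw ↦ (hsurj z hz).1 ?_
    have h0 : ∀ ξ : EuclideanSpace ℝ (Fin m) →L[ℝ] ℝ,
        ξ (mfderiv 𝓘(ℝ, EuclideanSpace ℝ (Fin m)) (𝓡 m) φ.symm z w) = 0 := by
      intro ξ
      obtain ⟨v, hv⟩ := hι (φ.symm z) ξ
      have := hT z hz v w
      rw [hw, inner_zero_right, hv] at this
      exact this.symm
    have h1 : ∀ X : EuclideanSpace ℝ (Fin m),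
        (∀ ξ : EuclideanSpace ℝ (Fin m) →L[ℝ] ℝ, ξ X = 0) → X = 0 := fun X hX ↦
      (inner_self_eq_zero (𝕜 := ℝ)).1 (hX (innerSL ℝ X))
    exact (h1 _ h0).trans (ContinuousLinearMap.map_zero
      (mfderiv 𝓘(ℝ, EuclideanSpace ℝ (Fin m)) (𝓡 m) φ.symm z)).symm
  have hK : ∀ y ∈ φ.source, ∀ v, v ∈ criticalSpace ι y ↔ ∀ w, ⟪v, fderiv ℝ G (φ y) w⟫_ℝ = 0 := by
    intro y hy v
    obtain ⟨z, hz, rfl⟩ : ∃ z ∈ φ.target, φ.symm z = y := ⟨φ y, φ.map_source hy, φ.left_inv hy⟩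
    rw [φ.right_inv hz]
    simp only [hT _ hz]
    constructor
    · intro hv w
      exact DFunLike.congr_fun (LinearMap.mem_ker.1 hv) _
    · intro hv
      refine LinearMap.mem_ker.2 (ContinuousLinearMap.ext fun X ↦ ?_)
      obtain ⟨w, rfl⟩ := (hsurj z hz).2 X
      exact hv w
  have hev : gaussMap ι =ᶠ[nhds x] fun y ↦ (fun T : EuclideanSpace ℝ (Fin m) →L[ℝ] E ↦
      T ∘L (((ContinuousLinearMap.compL ℝ _ E ℝ).flip T ∘L innerSL ℝ) ∘L T).inverse ∘L
        ((ContinuousLinearMap.compL ℝ _ E ℝ).flip T ∘L innerSL ℝ)) (fderiv ℝ G (φ y)) := by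
    filter_upwards [extChartAt_source_mem_nhds (I := 𝓡 m) x] with y hy
    exact (starProjection_orthogonal_eq _ _ (hTinj _ (φ.map_source hy)) (hK y hy)).2
  have hx := mem_extChartAt_source (I := 𝓡 m) x
  refine MDifferentiableAt.congr_of_eventuallyEq ?_ hev
  have hd : MDifferentiableAt (𝓡 m) 𝓘(ℝ, EuclideanSpace ℝ (Fin m) →L[ℝ] E)
      (fun y ↦ fderiv ℝ G (φ y)) x := by
    have : DifferentiableAt ℝ (fderiv ℝ G) (φ x) :=
      ((hG.contDiffAt (hopen.mem_nhds (φ.map_source hx))).fderiv_right (m := 1)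
        (by norm_cast)).differentiableAt (by simp)
    exact this.comp_mdifferentiableAt (mdifferentiableAt_extChartAt (mem_chart_source _ x))
  refine DifferentiableAt.comp_mdifferentiableAt (g := fun T : EuclideanSpace ℝ (Fin m) →L[ℝ] E ↦
      T ∘L (((ContinuousLinearMap.compL ℝ _ E ℝ).flip T ∘L innerSL ℝ) ∘L T).inverse ∘L
        ((ContinuousLinearMap.compL ℝ _ E ℝ).flip T ∘L innerSL ℝ)) ?_ hd
  obtain ⟨e, he⟩ := (starProjection_orthogonal_eq _ _ (hTinj _ (φ.map_source hx)) (hK x hx)).1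
  have hA : DifferentiableAt ℝ (fun T : EuclideanSpace ℝ (Fin m) →L[ℝ] E ↦
      (ContinuousLinearMap.compL ℝ _ E ℝ).flip T ∘L innerSL ℝ) (fderiv ℝ G (φ x)) := by
    fun_prop
  refine differentiableAt_id.clm_comp (DifferentiableAt.clm_comp ?_ hA)
  refine DifferentiableAt.comp (g := ContinuousLinearMap.inverse)
    (f := fun T : EuclideanSpace ℝ (Fin m) →L[ℝ] E ↦
      ((ContinuousLinearMap.compL ℝ _ E ℝ).flip T ∘L innerSL ℝ) ∘L T) _ ?_
    (hA.clm_comp differentiableAt_id)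
  change DifferentiableAt ℝ _ (((ContinuousLinearMap.compL ℝ _ E ℝ).flip (fderiv ℝ G (φ x)) ∘L
    innerSL ℝ) ∘L (fderiv ℝ G (φ x)))
  rw [← he]
  exact (contDiffAt_map_inverse (n := 1) e).differentiableAt (by simp)

/-- For every section `u` of `K^⊥`, one has `Ξ(X, u) = (D_X u)^0`. -/
theorem shapeOperator_section (hι : IsAmple ι) (x : M) (X : TangentSpace (𝓡 m) x)
    (u : ∀ y : M, (criticalSpace ι y)ᗮ)
    (hu : MDifferentiableAt (𝓡 m) 𝓘(ℝ, E) (fun y ↦ (u y : E)) x) :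
    shapeOperator ι x X (u x) =
      (criticalSpace ι x).orthogonalProjectionOnto (mvfderiv (𝓡 m) (fun y ↦ (u y : E)) x X) := by
  have hP := hι.mdifferentiableAt_gaussMap x
  have hPu : (fun y ↦ gaussMap ι y (u y)) = fun y ↦ (u y : E) := by
    ext y
    exact Submodule.starProjection_eq_self_iff.2 (u y).2
  have hD : mvfderiv (𝓡 m) (fun y ↦ (u y : E)) x X =
      mvfderiv (𝓡 m) (gaussMap ι) x X (u x) +
        gaussMap ι x (mvfderiv (𝓡 m) (fun y ↦ (u y : E)) x X) := by
    have hPu' : MDifferentiableAt (𝓡 m) 𝓘(ℝ, E) (fun y ↦ gaussMap ι y (u y)) x := by rwa [hPu]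
    have h1 := hP.differentiableWithinAt_writtenInExtChartAt
    have h2 := hu.differentiableWithinAt_writtenInExtChartAt
    rw [ModelWithCorners.range_eq_univ, differentiableWithinAt_univ] at h1 h2
    conv_lhs => rw [← hPu, hPu'.mvfderiv]
    rw [hu.mvfderiv, hP.mvfderiv, ModelWithCorners.range_eq_univ, fderivWithin_univ,
      fderivWithin_univ, fderivWithin_univ]
    have h3 := DFunLike.congr_fun (fderiv_clm_apply h1 h2) X
    refine Eq.trans h3 ?_
    have h4 : writtenInExtChartAt (𝓡 m) 𝓘(ℝ, E →L[ℝ] E) x (gaussMap ι) (extChartAt (𝓡 m) x x) =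
        gaussMap ι x := congrArg (gaussMap ι) (extChartAt_to_inv x)
    have h5 : writtenInExtChartAt (𝓡 m) 𝓘(ℝ, E) x (fun y ↦ (u y : E)) (extChartAt (𝓡 m) x x) =
        u x := congrArg (fun y ↦ (u y : E)) (extChartAt_to_inv x)
    rw [h4, h5]
    exact add_comm _ _
  have h0 : (criticalSpace ι x).orthogonalProjectionOnto
      (gaussMap ι x (mvfderiv (𝓡 m) (fun y ↦ (u y : E)) x X)) = 0 :=
    Submodule.orthogonalProjectionOnto_eq_zero_iff.2 (Submodule.starProjection_apply_mem _ _)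
  conv_rhs => rw [hD, map_add, h0, add_zero]
  rfl

end ShapeOperator

section Determinant

variable {m : ℕ} {M : Type*} [TopologicalSpace M] [ChartedSpace (EuclideanSpace ℝ (Fin m)) M]
  {E : Type*} [NormedAddCommGroup E] [InnerProductSpace ℝ E] [FiniteDimensional ℝ E]
  {ι : E →ₗ[ℝ] C^∞⟮𝓡 m, M; ℝ⟯}

instance (x : M) : FiniteDimensional ℝ (TangentSpace (𝓡 m) x) :=
  inferInstanceAs (FiniteDimensional ℝ (EuclideanSpace ℝ (Fin m)))

theorem finrank_tangentSpace_eq (x : M) : Module.finrank ℝ (TangentSpace (𝓡 m) x) = m :=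
  finrank_euclideanSpace_fin

theorem IsAmple.finrank_orthogonal (hι : IsAmple ι) (x : M) :
    Module.finrank ℝ (criticalSpace ι x)ᗮ = m := by
  have h1 := (adjunction ι x).finrank_range_add_finrank_ker
  have h2 := (criticalSpace ι x).finrank_add_finrank_orthogonal
  rw [LinearMap.range_eq_top.2 (hι x), finrank_top] at h1
  have h3 : Module.finrank ℝ (TangentSpace (𝓡 m) x →L[ℝ] ℝ) = m := by
    have : T2Space (TangentSpace (𝓡 m) x) :=
      inferInstanceAs (T2Space (EuclideanSpace ℝ (Fin m)))
    have L : (TangentSpace (𝓡 m) x →ₗ[ℝ] ℝ) ≃ₗ[ℝ] (TangentSpace (𝓡 m) x →L[ℝ] ℝ) :=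
      LinearMap.toContinuousLinearMap
    rw [← L.finrank_eq]
    exact Subspace.dual_finrank_eq.trans (finrank_tangentSpace_eq x)
  change Module.finrank ℝ (criticalSpace ι x) + _ = _ at h2
  change _ + Module.finrank ℝ (criticalSpace ι x) = _ at h1
  omega

variable [RiemannianBundle (fun x : M ↦ TangentSpace (𝓡 m) x)]

/-- The matrix `Ξ_x(e_i, u_j) · v` of the bilinear form `Ξ_x · v` on `T_x M × K_x^⊥` in the
bases `e` and `u`. -/
def shapeMatrix (ι : E →ₗ[ℝ] C^∞⟮𝓡 m, M; ℝ⟯) (x : M)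
    (e : OrthonormalBasis (Fin m) ℝ (TangentSpace (𝓡 m) x))
    (u : OrthonormalBasis (Fin m) ℝ (criticalSpace ι x)ᗮ) (v : criticalSpace ι x) :
    Matrix (Fin m) (Fin m) ℝ :=
  Matrix.of fun i j ↦ ⟪shapeOperator ι x (e i) (u j), v⟫_ℝ

/-- The number `|det Ξ_x · v|`, computed in some orthonormal bases of `T_x M` and of `K_x^⊥`.
It does not depend on them, see `absDetShape_eq`. -/
def absDetShape (hι : IsAmple ι) (x : M) (v : criticalSpace ι x) : ℝ :=
  |(shapeMatrix ι x
    ((stdOrthonormalBasis ℝ (TangentSpace (𝓡 m) x)).reindex (finCongr (finrank_tangentSpace_eq x)))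
    ((stdOrthonormalBasis ℝ (criticalSpace ι x)ᗮ).reindex (finCongr (hι.finrank_orthogonal x)))
    v).det|

theorem absDetShape_eq (hι : IsAmple ι) (x : M) (v : criticalSpace ι x)
    (e : OrthonormalBasis (Fin m) ℝ (TangentSpace (𝓡 m) x))
    (u : OrthonormalBasis (Fin m) ℝ (criticalSpace ι x)ᗮ) :
    absDetShape hι x v = |(shapeMatrix ι x e u v).det| := by
  have key : ∀ (e e' : OrthonormalBasis (Fin m) ℝ (TangentSpace (𝓡 m) x))
      (u u' : OrthonormalBasis (Fin m) ℝ (criticalSpace ι x)ᗮ),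
      |(shapeMatrix ι x e' u' v).det| = |(shapeMatrix ι x e u v).det| := by
    intro e e' u u'
    have hB : ∀ (e : OrthonormalBasis (Fin m) ℝ (TangentSpace (𝓡 m) x))
        (u : OrthonormalBasis (Fin m) ℝ (criticalSpace ι x)ᗮ),
        shapeMatrix ι x e u v = LinearMap.toMatrix₂ e.toBasis u.toBasis
          ((shapeOperator ι x).compr₂ (innerₗ _ v)) := by
      intro e u
      ext i j
      simp [shapeMatrix, LinearMap.toMatrix₂_apply, real_inner_comm]
    rw [hB, hB, ← LinearMap.toMatrix₂_mul_basis_toMatrix e.toBasis u.toBasis e'.toBasis u'.toBasis,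
      Matrix.det_mul, Matrix.det_mul, Matrix.det_transpose, abs_mul, abs_mul]
    have h1 : |(e.toBasis.toMatrix e').det| = 1 := e.det_to_matrix_orthonormalBasis e'
    have h2 : |(u.toBasis.toMatrix u').det| = 1 := u.det_to_matrix_orthonormalBasis u'
    simp only [OrthonormalBasis.coe_toBasis, h1, h2, one_mul, mul_one]
  exact key _ _ _ _

end Determinant

/-- The expected number of critical points of a random function of the family `ι`, with parameter
uniformly distributed in the unit sphere `S(E)`. -/
def expectedCritical {m : ℕ} {M : Type*} [TopologicalSpace M]
    [ChartedSpace (EuclideanSpace ℝ (Fin m)) M]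
    {E : Type*} [NormedAddCommGroup E] [InnerProductSpace ℝ E] [FiniteDimensional ℝ E]
    [MeasurableSpace E] [BorelSpace E] (ι : E →ₗ[ℝ] C^∞⟮𝓡 m, M; ℝ⟯) : ℝ≥0∞ :=
  (sphereMeasure E univ)⁻¹ * ∫⁻ v, (numCritical ι (v : E) : ℝ≥0∞) ∂(sphereMeasure E)

end

/-!
A point `x` is critical for `v` exactly when `v ∈ K_x`, so `∫ μ_M(v) dv` counts, with multiplicity,
the points of the total space of the bundle `K` above each `v ∈ E`. In a chart, orthonormal frames
`A` of `K^⊥` and `B` of `K` parametrize this space by `(z, c) ↦ B z c`, and the area formula turns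
the count into an integral of the Jacobian of this map. Differentiating `⟪A z a, B z c⟫ = 0` shows
that the Jacobian is `|det ⟪(∂_i A) a_j, B z c⟫|`, which is `|det Ξ_x · v|` times the Riemannian
volume density at `v = B z c`. The integrals over unit spheres are replaced by integrals over unit
balls throughout: by homogeneity this multiplies them by `dim E` on the left and by `dim K_x + m` on
the right, and the two factors agree.
-/

/-! ### The area formula with multiplicities -/

section AreaFormula

open scoped NNReal Function

lemma encard_iUnion_eq_tsum {α ι : Type*} [Countable ι] {s : ι → Set α}
    (hs : Pairwise (Disjoint on s)) :
    ((⋃ i, s i).encard : ℝ≥0∞) = ∑' i, ((s i).encard : ℝ≥0∞) := by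
  let _ : MeasurableSpace α := ⊤
  simp only [← Measure.count_apply MeasurableSpace.measurableSet_top]
  exact measure_iUnion hs fun _ ↦ MeasurableSpace.measurableSet_top

lemma encard_fiber_eq_indicator {α β : Type*} {f : α → β} {s : Set α} (hf : InjOn f s) (y : β) :
    ({x ∈ s | f x = y}.encard : ℝ≥0∞) = (f '' s).indicator 1 y := by
  by_cases hy : y ∈ f '' s
  · obtain ⟨x, hx, rfl⟩ := hy
    have h : {x' ∈ s | f x' = f x} = {x} :=
      Subset.antisymm (fun x' hx' ↦ hf hx'.1 hx hx'.2) (singleton_subset_iff.2 ⟨hx, rfl⟩)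
    simp [h, mem_image_of_mem f hx]
  · have h : {x ∈ s | f x = y} = ∅ :=
      eq_empty_of_forall_notMem fun x hx ↦ hy ⟨x, hx.1, hx.2⟩
    simp [h, hy]

lemma encard_fiber_eq_tsum_indicator {α β : Type*} {f : α → β} {t : ℕ → Set α}
    (hdisj : Pairwise (Disjoint on t)) (hinj : ∀ n, InjOn f (t n)) (y : β) :
    ({x ∈ ⋃ n, t n | f x = y}.encard : ℝ≥0∞) = ∑' n, (f '' t n).indicator 1 y := by
  have h : {x ∈ ⋃ n, t n | f x = y} = ⋃ n, {x ∈ t n | f x = y} := by ext; simp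
  rw [h, encard_iUnion_eq_tsum fun i j hij ↦ (hdisj hij).mono (sep_subset _ _) (sep_subset _ _)]
  exact tsum_congr fun n ↦ encard_fiber_eq_indicator (hinj n) y

lemma encard_fiber_comp_equiv {α β γ : Type*} (e : α ≃ β) (g : β → γ) (t : Set β) (y : γ) :
    {x ∈ e ⁻¹' t | g (e x) = y}.encard = {x ∈ t | g x = y}.encard :=
  encard_preimage_of_bijective e.bijective {x ∈ t | g x = y}

variable {F : Type*} [NormedAddCommGroup F] [NormedSpace ℝ F] [FiniteDimensional ℝ F]

lemma exists_injOn_of_approximatesLinearOn (A : F →L[ℝ] F) :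
    ∃ r : ℝ≥0, r ≠ 0 ∧
      (A.det ≠ 0 → ∀ (f : F → F) (s : Set F), ApproximatesLinearOn f A s r → InjOn f s) := by
  by_cases hA : A.det = 0
  · exact ⟨1, one_ne_zero, fun h ↦ absurd hA h⟩
  let e := A.toContinuousLinearEquivOfDetNeZero hA
  have he : (e : F →L[ℝ] F) = A := A.coe_toContinuousLinearEquivOfDetNeZero hA
  rcases e.subsingleton_or_nnnorm_symm_pos with hF | hpos
  · exact ⟨1, one_ne_zero, fun _ f s _ ↦ injOn_of_subsingleton f s⟩
  · have hinv : 0 < ‖(e.symm : F →L[ℝ] F)‖₊⁻¹ := inv_pos.2 hpos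
    refine ⟨‖(e.symm : F →L[ℝ] F)‖₊⁻¹ / 2, (half_pos hinv).ne', fun _ f s hf ↦ ?_⟩
    rw [← he] at hf
    exact hf.injOn (.inr (half_lt_self hinv))

variable [MeasurableSpace F] [BorelSpace F] {f : F → F} {s : Set F}

lemma exists_partition_injOn_of_det_ne_zero (hs : MeasurableSet s)
    (hf : ∀ x ∈ s, DifferentiableAt ℝ f x) (hdet : ∀ x ∈ s, (fderiv ℝ f x).det ≠ 0) :
    ∃ t : ℕ → Set F, Pairwise (Disjoint on t) ∧ (∀ n, MeasurableSet (t n)) ∧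
      ⋃ n, t n = s ∧ ∀ n, InjOn f (t n) := by
  rcases s.eq_empty_or_nonempty with rfl | hne
  · exact ⟨fun _ ↦ ∅, fun _ _ _ ↦ disjoint_bot_left, by simp, by simp, by simp⟩
  choose r hr0 hr using exists_injOn_of_approximatesLinearOn (F := F)
  obtain ⟨t, A, hdisj, htm, hst, happrox, hA⟩ :=
    exists_partition_approximatesLinearOn_of_hasFDerivWithinAt f s (fderiv ℝ f)
      (fun x hx ↦ (hf x hx).hasFDerivAt.hasFDerivWithinAt) r hr0
  refine ⟨fun n ↦ s ∩ t n, fun i j hij ↦ (hdisj hij).mono inter_subset_right inter_subset_right,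
    fun n ↦ hs.inter (htm n), by rw [← inter_iUnion, inter_eq_left.2 hst], fun n ↦ ?_⟩
  obtain ⟨y, hy, hAn⟩ := hA hne n
  exact hr (A n) (hAn ▸ hdet y hy) f _ (happrox n)

lemma measurable_encard_fiber_of_det_ne_zero (hs : MeasurableSet s)
    (hf : ∀ x ∈ s, DifferentiableAt ℝ f x) (hdet : ∀ x ∈ s, (fderiv ℝ f x).det ≠ 0) :
    Measurable fun y ↦ ({x ∈ s | f x = y}.encard : ℝ≥0∞) := by
  obtain ⟨t, hdisj, htm, rfl, hinj⟩ := exists_partition_injOn_of_det_ne_zero hs hf hdet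
  simp only [encard_fiber_eq_tsum_indicator hdisj hinj]
  refine Measurable.tsum fun n ↦ measurable_one.indicator ?_
  exact measurable_image_of_fderivWithin (htm n)
    (fun x hx ↦ (hf x (mem_iUnion_of_mem n hx)).hasFDerivAt.hasFDerivWithinAt) (hinj n)

variable (μ : Measure F) [μ.IsAddHaarMeasure]

lemma lintegral_encard_fiber_of_det_ne_zero (hs : MeasurableSet s)
    (hf : ∀ x ∈ s, DifferentiableAt ℝ f x) (hdet : ∀ x ∈ s, (fderiv ℝ f x).det ≠ 0) :
    ∫⁻ y, ({x ∈ s | f x = y}.encard : ℝ≥0∞) ∂μ =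
      ∫⁻ x in s, ENNReal.ofReal |(fderiv ℝ f x).det| ∂μ := by
  obtain ⟨t, hdisj, htm, rfl, hinj⟩ := exists_partition_injOn_of_det_ne_zero hs hf hdet
  have hderiv : ∀ n, ∀ x ∈ t n, HasFDerivWithinAt f (fderiv ℝ f x) (t n) x := fun n x hx ↦
    (hf x (mem_iUnion_of_mem n hx)).hasFDerivAt.hasFDerivWithinAt
  have himage : ∀ n, MeasurableSet (f '' t n) := fun n ↦
    measurable_image_of_fderivWithin (htm n) (hderiv n) (hinj n)
  simp only [encard_fiber_eq_tsum_indicator hdisj hinj]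
  rw [lintegral_tsum fun n ↦ (measurable_one.indicator (himage n)).aemeasurable,
    lintegral_iUnion htm hdisj]
  refine tsum_congr fun n ↦ ?_
  rw [lintegral_indicator_one (himage n),
    lintegral_abs_det_fderiv_eq_addHaar_image μ (htm n) (hderiv n) (hinj n)]

lemma measurableSet_det_fderiv_ne_zero (f : F → F) :
    MeasurableSet {x | (fderiv ℝ f x).det ≠ 0} :=
  (ContinuousLinearMap.continuous_det.measurable.comp (measurable_fderiv ℝ f))
    (measurableSet_singleton 0).compl

lemma encard_fiber_ae_eq_det_ne_zero (hf : ∀ x ∈ s, DifferentiableAt ℝ f x) :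
    (fun y ↦ ({x ∈ s | f x = y}.encard : ℝ≥0∞)) =ᵐ[μ]
      fun y ↦ ({x ∈ s ∩ {x | (fderiv ℝ f x).det ≠ 0} | f x = y}.encard : ℝ≥0∞) := by
  -- Sard: the critical values form a null set.
  have hnull : μ (f '' {x ∈ s | (fderiv ℝ f x).det = 0}) = 0 :=
    addHaar_image_eq_zero_of_det_fderivWithin_eq_zero μ
      (fun x hx ↦ (hf x hx.1).hasFDerivAt.hasFDerivWithinAt) fun x hx ↦ hx.2
  filter_upwards [measure_eq_zero_iff_ae_notMem.1 hnull] with y hy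
  congr 2
  ext x
  exact ⟨fun ⟨hx, hxy⟩ ↦ ⟨⟨hx, fun h0 ↦ hy ⟨x, ⟨hx, h0⟩, hxy⟩⟩, hxy⟩,
    fun ⟨hx, hxy⟩ ↦ ⟨hx.1, hxy⟩⟩

lemma aemeasurable_encard_fiber (hs : MeasurableSet s) (hf : ∀ x ∈ s, DifferentiableAt ℝ f x) :
    AEMeasurable (fun y ↦ ({x ∈ s | f x = y}.encard : ℝ≥0∞)) μ :=
  (measurable_encard_fiber_of_det_ne_zero (hs.inter (measurableSet_det_fderiv_ne_zero f))
    (fun x hx ↦ hf x hx.1) fun _ hx ↦ hx.2).aemeasurable.congr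
      (encard_fiber_ae_eq_det_ne_zero μ hf).symm

theorem lintegral_encard_fiber (hs : MeasurableSet s) (hf : ∀ x ∈ s, DifferentiableAt ℝ f x) :
    ∫⁻ y, ({x ∈ s | f x = y}.encard : ℝ≥0∞) ∂μ =
      ∫⁻ x in s, ENNReal.ofReal |(fderiv ℝ f x).det| ∂μ := by
  have hm := measurableSet_det_fderiv_ne_zero f
  rw [lintegral_congr_ae (encard_fiber_ae_eq_det_ne_zero μ hf),
    lintegral_encard_fiber_of_det_ne_zero μ (hs.inter hm) (fun x hx ↦ hf x hx.1) fun _ hx ↦ hx.2,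
    ← lintegral_inter_add_sdiff _ s hm, setLIntegral_eq_zero (hs.diff hm), add_zero]
  intro x hx
  have h0 : (fderiv ℝ f x).det = 0 := not_not.1 fun h ↦ hx.2 h
  simp [h0]

variable {G : Type*} [NormedAddCommGroup G] [NormedSpace ℝ G] [MeasurableSpace G] [BorelSpace G]
  {ν : Measure G} {g : G → F} {t : Set G}

lemma aemeasurable_encard_fiber_of_equiv (L : F ≃L[ℝ] G) (ht : MeasurableSet t)
    (hg : ∀ x ∈ t, DifferentiableAt ℝ g x) :
    AEMeasurable (fun y ↦ ({x ∈ t | g x = y}.encard : ℝ≥0∞)) μ := by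
  have h := aemeasurable_encard_fiber μ (L.continuous.measurable ht)
    fun x hx ↦ (hg (L x) hx).comp x L.differentiableAt
  simp only [← encard_fiber_comp_equiv L.toEquiv]
  exact h

lemma lintegral_encard_fiber_of_measurePreserving {L : F ≃L[ℝ] G} (hL : MeasurePreserving L μ ν)
    (ht : MeasurableSet t) (hg : ∀ x ∈ t, DifferentiableAt ℝ g x) :
    ∫⁻ y, ({x ∈ t | g x = y}.encard : ℝ≥0∞) ∂μ =
      ∫⁻ x in t, ENNReal.ofReal |(fderiv ℝ g x ∘L L : F →L[ℝ] F).det| ∂ν := by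
  have hLt : MeasurableSet (L ⁻¹' t) := L.continuous.measurable ht
  have h := lintegral_encard_fiber μ hLt fun x hx ↦ (hg (L x) hx).comp x L.differentiableAt
  simp only [← encard_fiber_comp_equiv L.toEquiv]
  refine h.trans ?_
  rw [← hL.setLIntegral_comp_preimage_emb L.toHomeomorph.measurableEmbedding]
  refine setLIntegral_congr_fun hLt fun x _ ↦ ?_
  simp only [L.comp_right_fderiv]

end AreaFormula

/-! ### Orthonormal frames -/

local notation "ℝ^" n:max => EuclideanSpace ℝ (Fin n)

section Frames

open InnerProductSpace

variable {X E : Type*} [NormedAddCommGroup X] [NormedSpace ℝ X]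
  [NormedAddCommGroup E] [InnerProductSpace ℝ E] {k m n : ℕ} {Ω : Set X} {p : ℕ∞ω}

lemma contDiffOn_gramSchmidt {f : Fin k → X → E} (hf : ∀ i, ContDiffOn ℝ p (f i) Ω)
    (hli : ∀ z ∈ Ω, LinearIndependent ℝ fun i ↦ f i z) (i : Fin k) :
    ContDiffOn ℝ p (fun z ↦ gramSchmidt ℝ (fun j ↦ f j z) i) Ω := by
  induction i using WellFoundedLT.induction with
  | ind i ih =>
    simp_rw [gramSchmidt_def ℝ _ i, Submodule.starProjection_singleton]
    refine (hf i).sub (ContDiffOn.sum fun j hj ↦ ?_)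
    have hj' := ih j (Finset.mem_Iio.1 hj)
    refine ((hj'.inner ℝ (hf i)).div (hj'.norm_sq ℝ) fun z hz ↦ ?_).smul hj'
    simpa using gramSchmidt_ne_zero j (hli z hz)

lemma contDiffOn_gramSchmidtNormed {f : Fin k → X → E} (hf : ∀ i, ContDiffOn ℝ p (f i) Ω)
    (hli : ∀ z ∈ Ω, LinearIndependent ℝ fun i ↦ f i z) (i : Fin k) :
    ContDiffOn ℝ p (fun z ↦ gramSchmidtNormed ℝ (fun j ↦ f j z) i) Ω := by
  have h := contDiffOn_gramSchmidt hf hli i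
  have h0 : ∀ z ∈ Ω, gramSchmidt ℝ (fun j ↦ f j z) i ≠ 0 := fun z hz ↦
    gramSchmidt_ne_zero i (hli z hz)
  exact ((h.norm ℝ h0).inv fun z hz ↦ norm_ne_zero_iff.2 (h0 z hz)).smul h

/-- The linear map `ℝ^k → E` sending the standard basis to the family `u`. -/
noncomputable def frameMap (u : Fin k → E) : ℝ^k →L[ℝ] E :=
  ∑ i, (EuclideanSpace.proj i).smulRight (u i)

lemma frameMap_apply (u : Fin k → E) (a : ℝ^k) : frameMap u a = ∑ i, a i • u i := by
  simp [frameMap]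

lemma frameMap_apply_single (T : ℝ^k →L[ℝ] E) :
    frameMap (fun i ↦ T (EuclideanSpace.single i 1)) = T := by
  ext a
  conv_rhs => rw [← (EuclideanSpace.basisFun (Fin k) ℝ).sum_repr a]
  simp [frameMap_apply]

lemma norm_frameMap {u : Fin k → E} (hu : Orthonormal ℝ u) (a : ℝ^k) : ‖frameMap u a‖ = ‖a‖ := by
  have h : ‖frameMap u a‖ ^ 2 = ‖a‖ ^ 2 := by
    rw [frameMap_apply, ← real_inner_self_eq_norm_sq, hu.inner_sum, EuclideanSpace.norm_sq_eq]
    simp [sq]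
  exact (sq_eq_sq₀ (norm_nonneg _) (norm_nonneg _)).1 h

lemma range_frameMap (u : Fin k → E) : (frameMap u).range = Submodule.span ℝ (range u) := by
  ext v
  rw [Submodule.mem_span_range_iff_exists_fun]
  constructor
  · rintro ⟨a, rfl⟩
    exact ⟨a, (frameMap_apply u a).symm⟩
  · rintro ⟨c, rfl⟩
    exact ⟨WithLp.toLp 2 c, frameMap_apply u _⟩

lemma contDiffOn_frameMap {f : Fin k → X → E} (hf : ∀ i, ContDiffOn ℝ p (f i) Ω) :
    ContDiffOn ℝ p (fun z ↦ frameMap fun i ↦ f i z) Ω := by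
  unfold frameMap
  exact ContDiffOn.sum fun i _ ↦ contDiffOn_const.smulRight (hf i)

lemma linearIndependent_apply_single {T : ℝ^k →L[ℝ] E} (hT : Function.Injective T) :
    LinearIndependent ℝ fun i ↦ T (EuclideanSpace.single i 1) := by
  have h := (EuclideanSpace.basisFun (Fin k) ℝ).toBasis.linearIndependent.map'
    T.toLinearMap (LinearMap.ker_eq_bot.2 hT)
  simpa [Function.comp_def] using h

lemma exists_isometric_frame {T : X → ℝ^k →L[ℝ] E} (hT : ContDiffOn ℝ p T Ω)
    (hinj : ∀ z ∈ Ω, Function.Injective (T z)) :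
    ∃ A : X → ℝ^k →L[ℝ] E, ContDiffOn ℝ p A Ω ∧
      ∀ z ∈ Ω, (∀ a, ‖A z a‖ = ‖a‖) ∧ (A z).range = (T z).range := by
  let f : Fin k → X → E := fun i z ↦ T z (EuclideanSpace.single i 1)
  have hf : ∀ i, ContDiffOn ℝ p (f i) Ω := fun i ↦ hT.clm_apply contDiffOn_const
  have hli : ∀ z ∈ Ω, LinearIndependent ℝ fun i ↦ f i z := fun z hz ↦
    linearIndependent_apply_single (hinj z hz)
  refine ⟨fun z ↦ frameMap (gramSchmidtNormed ℝ fun j ↦ f j z),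
    contDiffOn_frameMap (contDiffOn_gramSchmidtNormed hf hli),
    fun z hz ↦ ⟨norm_frameMap (gramSchmidtNormed_orthonormal (hli z hz)), ?_⟩⟩
  rw [range_frameMap, span_gramSchmidtNormed_range, span_gramSchmidt, ← range_frameMap,
    frameMap_apply_single]

lemma inner_map_map_of_norm {T : ℝ^k →L[ℝ] E} (hT : ∀ a, ‖T a‖ = ‖a‖) (a b : ℝ^k) :
    ⟪T a, T b⟫_ℝ = ⟪a, b⟫_ℝ :=
  LinearIsometry.inner_map_map ⟨T.toLinearMap, hT⟩ a b

/-- A pair of `C¹` families of isometries `A z : ℝ^m → E` and `B z : ℝ^n → E`, parametrized by an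
open set `Ω`, whose ranges are orthogonal complements of each other. -/
structure IsFramePair (A : X → ℝ^m →L[ℝ] E) (B : X → ℝ^n →L[ℝ] E) (Ω : Set X) : Prop where
  isOpen : IsOpen Ω
  finrank_eq : Module.finrank ℝ E = m + n
  contDiffOn_left : ContDiffOn ℝ 1 A Ω
  contDiffOn_right : ContDiffOn ℝ 1 B Ω
  norm_left : ∀ z ∈ Ω, ∀ a, ‖A z a‖ = ‖a‖
  norm_right : ∀ z ∈ Ω, ∀ c, ‖B z c‖ = ‖c‖
  inner_eq_zero : ∀ z ∈ Ω, ∀ a c, ⟪A z a, B z c⟫_ℝ = 0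

/-- The component of `κ` orthogonal to the range of `A`, when `A` is an isometry. -/
noncomputable def orthogonalPart (A : ℝ^m →L[ℝ] E) (κ : ℝ^n →L[ℝ] E) : ℝ^n →L[ℝ] E :=
  κ - ∑ i, (innerSL ℝ (A (EuclideanSpace.single i 1)) ∘L κ).smulRight
    (A (EuclideanSpace.single i 1))

lemma inner_orthogonalPart {A : ℝ^m →L[ℝ] E} (hA : ∀ a, ‖A a‖ = ‖a‖) (κ : ℝ^n →L[ℝ] E)
    (a : ℝ^m) (c : ℝ^n) : ⟪A a, orthogonalPart A κ c⟫_ℝ = 0 := by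
  have h : ∀ i, ⟪A a, A (EuclideanSpace.single i 1)⟫_ℝ = a i := fun i ↦ by
    rw [inner_map_map_of_norm hA, EuclideanSpace.inner_single_right]
    simp
  have hAa : A a = ∑ i, a i • A (EuclideanSpace.single i 1) := by
    rw [← frameMap_apply, frameMap_apply_single]
  simp only [orthogonalPart, sub_apply, sum_apply, ContinuousLinearMap.smulRight_apply,
    ContinuousLinearMap.comp_apply, innerSL_apply_apply, inner_sub_right, inner_sum,
    inner_smul_right, h]
  rw [hAa, sum_inner, sub_eq_zero]
  exact Finset.sum_congr rfl fun i _ ↦ by rw [real_inner_smul_left, mul_comm]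

lemma contDiffOn_orthogonalPart {A : X → ℝ^m →L[ℝ] E} (hA : ContDiffOn ℝ p A Ω)
    (κ : ℝ^n →L[ℝ] E) : ContDiffOn ℝ p (fun z ↦ orthogonalPart (A z) κ) Ω := by
  unfold orthogonalPart
  have hAi : ∀ i, ContDiffOn ℝ p (fun z ↦ A z (EuclideanSpace.single i 1)) Ω := fun i ↦
    hA.clm_apply contDiffOn_const
  exact contDiffOn_const.sub (ContDiffOn.sum fun i _ ↦
    (((innerSL ℝ).contDiff.comp_contDiffOn (hAi i)).clm_comp contDiffOn_const).smulRight (hAi i))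

lemma orthogonalPart_eq_self {A : ℝ^m →L[ℝ] E} {κ : ℝ^n →L[ℝ] E}
    (h : ∀ a c, ⟪A a, κ c⟫_ℝ = 0) : orthogonalPart A κ = κ := by
  ext c
  simp [orthogonalPart, h]

variable [FiniteDimensional ℝ E]

lemma exists_isometry_orthogonal_range {T : ℝ^m →L[ℝ] E} (hT : Function.Injective T)
    (hn : Module.finrank ℝ E = m + n) :
    ∃ κ : ℝ^n →L[ℝ] E, (∀ c, ‖κ c‖ = ‖c‖) ∧ ∀ a c, ⟪T a, κ c⟫_ℝ = 0 := by
  have hrange : Module.finrank ℝ T.range = m := by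
    rw [LinearMap.finrank_range_of_inj hT, finrank_euclideanSpace_fin]
  have hfr : Module.finrank ℝ (T.range)ᗮ = n := by
    have := (T.range).finrank_add_finrank_orthogonal
    omega
  let e : ℝ^n ≃ₗᵢ[ℝ] (T.range)ᗮ :=
    ((stdOrthonormalBasis ℝ (T.range)ᗮ).reindex (finCongr hfr)).repr.symm
  exact ⟨(T.range)ᗮ.subtypeL ∘L e.toContinuousLinearEquiv, e.norm_map,
    fun a c ↦ (Submodule.mem_orthogonal _ _).1 (e c).2 _ ⟨a, rfl⟩⟩

lemma exists_complementary_frame {A : X → ℝ^m →L[ℝ] E} (hΩ : IsOpen Ω)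
    (hA : ContDiffOn ℝ p A Ω) (hnorm : ∀ z ∈ Ω, ∀ a, ‖A z a‖ = ‖a‖) {z₀ : X} (hz₀ : z₀ ∈ Ω)
    (hn : Module.finrank ℝ E = m + n) :
    ∃ Ω' ⊆ Ω, IsOpen Ω' ∧ z₀ ∈ Ω' ∧ ∃ B : X → ℝ^n →L[ℝ] E, ContDiffOn ℝ p B Ω' ∧
      ∀ z ∈ Ω', (∀ c, ‖B z c‖ = ‖c‖) ∧ ∀ a c, ⟪A z a, B z c⟫_ℝ = 0 := by
  obtain ⟨κ, hκ, hAκ⟩ := exists_isometry_orthogonal_range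
    (LinearIsometry.injective ⟨(A z₀).toLinearMap, hnorm z₀ hz₀⟩) hn
  have hS := contDiffOn_orthogonalPart hA κ
  let Ω' := Ω ∩ (fun z ↦ orthogonalPart (A z) κ) ⁻¹' {S | Function.Injective S}
  have hΩ'Ω : Ω' ⊆ Ω := inter_subset_left
  have hz₀' : z₀ ∈ Ω' := by
    refine ⟨hz₀, ?_⟩
    rw [mem_preimage, orthogonalPart_eq_self hAκ]
    exact LinearIsometry.injective ⟨κ.toLinearMap, hκ⟩
  obtain ⟨B, hB, hB'⟩ := exists_isometric_frame (hS.mono hΩ'Ω) fun z hz ↦ hz.2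
  refine ⟨Ω', hΩ'Ω, hS.continuousOn.isOpen_inter_preimage hΩ
    ContinuousLinearMap.isOpen_injective, hz₀', B, hB, fun z hz ↦ ⟨(hB' z hz).1, fun a c ↦ ?_⟩⟩
  obtain ⟨c', hc'⟩ : B z c ∈ (orthogonalPart (A z) κ).range := (hB' z hz).2 ▸ ⟨c, rfl⟩
  rw [← hc']
  exact inner_orthogonalPart (hnorm z (hΩ'Ω hz)) κ a c'

lemma exists_isFramePair {T : X → ℝ^m →L[ℝ] E} (hΩ : IsOpen Ω) (hT : ContDiffOn ℝ 1 T Ω)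
    (hinj : ∀ z ∈ Ω, Function.Injective (T z)) {z₀ : X} (hz₀ : z₀ ∈ Ω)
    (hn : Module.finrank ℝ E = m + n) :
    ∃ Ω' ⊆ Ω, z₀ ∈ Ω' ∧ ∃ (A : X → ℝ^m →L[ℝ] E) (B : X → ℝ^n →L[ℝ] E),
      IsFramePair A B Ω' ∧ ∀ z ∈ Ω', (A z).range = (T z).range := by
  obtain ⟨A, hA, hA'⟩ := exists_isometric_frame hT hinj
  obtain ⟨Ω', hsub, hopen, hz₀', B, hB, hB'⟩ :=
    exists_complementary_frame hΩ hA (fun z hz ↦ (hA' z hz).1) hz₀ hn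
  exact ⟨Ω', hsub, hz₀', A, B,
    { isOpen := hopen
      finrank_eq := hn
      contDiffOn_left := hA.mono hsub
      contDiffOn_right := hB
      norm_left := fun z hz ↦ (hA' z (hsub hz)).1
      norm_right := fun z hz ↦ (hB' z hz).1
      inner_eq_zero := fun z hz ↦ (hB' z hz).2 },
    fun z hz ↦ (hA' z (hsub hz)).2⟩

end Frames

/-! ### Jacobian determinants -/

section Determinants

lemma abs_det_eq_one_of_measurePreserving {F : Type*} [NormedAddCommGroup F] [NormedSpace ℝ F]
    [FiniteDimensional ℝ F] [MeasurableSpace F] [BorelSpace F] {μ : Measure F}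
    [μ.IsAddHaarMeasure] {Q : F ≃L[ℝ] F} (hQ : MeasurePreserving Q μ μ) :
    |(Q : F →L[ℝ] F).det| = 1 := by
  have hvol := μ.addHaar_image_continuousLinearMap (Q : F →L[ℝ] F) (ball 0 1)
  rw [← hQ.measure_preimage_emb Q.toHomeomorph.measurableEmbedding] at hvol
  have hpre : Q ⁻¹' ((Q : F →L[ℝ] F) '' ball 0 1) = ball 0 1 := Q.injective.preimage_image _
  rw [hpre] at hvol
  have hone := (ENNReal.mul_left_inj (measure_ball_pos μ 0 one_pos).ne'
    measure_ball_lt_top.ne).1 ((one_mul _).trans hvol)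
  exact ENNReal.ofReal_eq_one.1 hone.symm

lemma det_prod_unipotent {R U W : Type*} [CommRing R] [AddCommGroup U] [Module R U]
    [Module.Free R U] [Module.Finite R U] [AddCommGroup W] [Module R W] [Module.Free R W]
    [Module.Finite R W] (S : U →ₗ[R] U) (T : U →ₗ[R] W) :
    LinearMap.det ((S ∘ₗ LinearMap.fst R U W).prod
      (T ∘ₗ LinearMap.fst R U W + LinearMap.snd R U W)) = LinearMap.det S := by
  classical
  let b := Module.Free.chooseBasis R U
  let c := Module.Free.chooseBasis R W
  have hblocks : LinearMap.toMatrix (b.prod c) (b.prod c) ((S ∘ₗ LinearMap.fst R U W).prod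
      (T ∘ₗ LinearMap.fst R U W + LinearMap.snd R U W)) =
      Matrix.fromBlocks (LinearMap.toMatrix b b S) 0 (LinearMap.toMatrix b c T) 1 := by
    ext i j
    rcases i with i | i <;> rcases j with j | j <;>
      simp [LinearMap.toMatrix_apply, Matrix.one_apply, Finsupp.single_apply, eq_comm]
  rw [← LinearMap.det_toMatrix (b.prod c), hblocks, Matrix.det_fromBlocks_zero₁₂, Matrix.det_one,
    mul_one, LinearMap.det_toMatrix]

variable {E U W : Type*} [NormedAddCommGroup E] [InnerProductSpace ℝ E] [FiniteDimensional ℝ E]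
  [NormedAddCommGroup U] [InnerProductSpace ℝ U] [FiniteDimensional ℝ U]
  [NormedAddCommGroup W] [InnerProductSpace ℝ W] [FiniteDimensional ℝ W]

lemma finrank_withLp_prod :
    Module.finrank ℝ (WithLp 2 (U × W)) = Module.finrank ℝ U + Module.finrank ℝ W :=
  (WithLp.prodContinuousLinearEquiv 2 ℝ U W).toLinearEquiv.finrank_eq.trans Module.finrank_prod

variable [MeasurableSpace E] [BorelSpace E] [MeasurableSpace U] [BorelSpace U]
  [MeasurableSpace W] [BorelSpace W]

lemma measurePreserving_toLp_trans (L : WithLp 2 (U × W) ≃ₗᵢ[ℝ] E) :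
    MeasurePreserving
      ((WithLp.prodContinuousLinearEquiv 2 ℝ U W).symm.trans L.toContinuousLinearEquiv) :=
  L.measurePreserving.comp (WithLp.volume_preserving_toLp U W)

lemma exists_measurePreserving_equiv_of_finrank_eq
    (h : Module.finrank ℝ E = Module.finrank ℝ U + Module.finrank ℝ W) :
    ∃ L : E ≃L[ℝ] U × W, MeasurePreserving L := by
  let e := (stdOrthonormalBasis ℝ (WithLp 2 (U × W))).equiv (stdOrthonormalBasis ℝ E)
    (finCongr (finrank_withLp_prod.trans h.symm))
  let L := (WithLp.prodContinuousLinearEquiv 2 ℝ U W).symm.trans e.toContinuousLinearEquiv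
  exact ⟨L.symm, (measurePreserving_toLp_trans e).symm L.toHomeomorph.toMeasurableEquiv⟩

lemma exists_measurePreserving_equiv_of_isometry
    (h : Module.finrank ℝ E = Module.finrank ℝ U + Module.finrank ℝ W) {a : U →L[ℝ] E}
    {b : W →L[ℝ] E} (ha : ∀ x, ‖a x‖ = ‖x‖) (hb : ∀ y, ‖b y‖ = ‖y‖)
    (hab : ∀ x y, ⟪a x, b y⟫_ℝ = 0) :
    ∃ L : (U × W) ≃L[ℝ] E, MeasurePreserving L ∧ ∀ p, L p = a p.1 + b p.2 := by
  let i : WithLp 2 (U × W) →ₗᵢ[ℝ] E :=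
    { toLinearMap := (a.coprod b).toLinearMap ∘ₗ
        (WithLp.prodContinuousLinearEquiv 2 ℝ U W).toLinearEquiv.toLinearMap
      norm_map' := fun p ↦ by
        have hsq : ‖a p.fst + b p.snd‖ ^ 2 = ‖p‖ ^ 2 := by
          rw [norm_add_sq_real, hab, ha, hb, WithLp.prod_norm_sq_eq_of_L2]
          ring
        exact (sq_eq_sq₀ (norm_nonneg _) (norm_nonneg _)).1 hsq }
  exact ⟨_, measurePreserving_toLp_trans
    (i.toLinearIsometryEquiv (finrank_withLp_prod.trans h.symm)), fun p ↦ rfl⟩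

lemma abs_det_comp_coprod_eq {m : ℕ} {a D : ℝ^m →L[ℝ] E} {b : W →L[ℝ] E}
    (h : Module.finrank ℝ E = m + Module.finrank ℝ W)
    (ha : ∀ x, ‖a x‖ = ‖x‖) (hb : ∀ y, ‖b y‖ = ‖y‖) (hab : ∀ x y, ⟪a x, b y⟫_ℝ = 0)
    {L : E ≃L[ℝ] ℝ^m × W} (hL : MeasurePreserving L) :
    |(D.coprod b ∘L L : E →L[ℝ] E).det| = |(Matrix.of fun i j ↦
      ⟪a (EuclideanSpace.single j 1), D (EuclideanSpace.single i 1)⟫_ℝ).det| := by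
  obtain ⟨P, hP, hPab⟩ := exists_measurePreserving_equiv_of_isometry (by simpa using h) ha hb hab
  let S : ℝ^m →ₗ[ℝ] ℝ^m := LinearMap.fst ℝ _ _ ∘ₗ P.symm.toLinearMap ∘ₗ D.toLinearMap
  let T : ℝ^m →ₗ[ℝ] W := LinearMap.snd ℝ _ _ ∘ₗ P.symm.toLinearMap ∘ₗ D.toLinearMap
  have hD : ∀ x, D x = a (S x) + b (T x) := fun x ↦ by
    simpa [S, T] using hPab (P.symm (D x))
  let K : ℝ^m × W →ₗ[ℝ] ℝ^m × W := (S ∘ₗ LinearMap.fst ℝ _ _).prod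
    (T ∘ₗ LinearMap.fst ℝ _ _ + LinearMap.snd ℝ _ _)
  have hfactor : (D.coprod b ∘L L : E →L[ℝ] E).toLinearMap =
      (P.toLinearEquiv.toLinearMap ∘ₗ K ∘ₗ P.toLinearEquiv.symm.toLinearMap) ∘ₗ
        ((L.trans P : E ≃L[ℝ] E) : E →L[ℝ] E).toLinearMap := by
    ext v
    change D (L v).1 + b (L v).2 = P (K (P.symm (P (L v))))
    rw [P.symm_apply_apply, hPab, hD]
    simp [K, add_assoc]
  have hS : ∀ x j, S x j = ⟪a (EuclideanSpace.single j 1), D x⟫_ℝ := fun x j ↦ by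
    rw [hD, inner_add_right, hab, add_zero, inner_map_map_of_norm ha]
    simp [EuclideanSpace.inner_single_left]
  have hmatrix : LinearMap.toMatrix (EuclideanSpace.basisFun (Fin m) ℝ).toBasis
      (EuclideanSpace.basisFun (Fin m) ℝ).toBasis S = (Matrix.of fun i j ↦
        ⟪a (EuclideanSpace.single j 1), D (EuclideanSpace.single i 1)⟫_ℝ).transpose := by
    ext j i
    simp [LinearMap.toMatrix_apply, hS]
  have hQ : |((L.trans P : E ≃L[ℝ] E) : E →L[ℝ] E).det| = 1 :=
    abs_det_eq_one_of_measurePreserving (hP.comp hL)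
  rw [ContinuousLinearMap.det] at hQ ⊢
  rw [hfactor, LinearMap.det_comp, abs_mul, hQ, mul_one,
    LinearMap.det_conj, det_prod_unipotent,
    ← LinearMap.det_toMatrix (EuclideanSpace.basisFun (Fin m) ℝ).toBasis, hmatrix,
    Matrix.det_transpose]

end Determinants

/-! ### The incidence formula -/

section Incidence

variable {E : Type*} [NormedAddCommGroup E] [InnerProductSpace ℝ E] {m n k : ℕ}

/-- The matrix `⟨D_i (A e_j), v⟩` of the second fundamental form, in the direction `v`, of the
bundle spanned by a frame `A`. -/
noncomputable def frameMatrix (A : ℝ^m → ℝ^k →L[ℝ] E) (z : ℝ^m) (v : E) :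
    Matrix (Fin m) (Fin k) ℝ :=
  Matrix.of fun i j ↦
    ⟪fderiv ℝ A z (EuclideanSpace.single i 1) (EuclideanSpace.single j 1), v⟫_ℝ

namespace IsFramePair

variable {A : ℝ^m → ℝ^m →L[ℝ] E} {B : ℝ^m → ℝ^n →L[ℝ] E} {Ω s : Set (ℝ^m)}

lemma differentiableAt_left (h : IsFramePair A B Ω) {z : ℝ^m} (hz : z ∈ Ω) :
    DifferentiableAt ℝ A z :=
  (h.contDiffOn_left.contDiffAt (h.isOpen.mem_nhds hz)).differentiableAt one_ne_zero

lemma differentiableAt_right (h : IsFramePair A B Ω) {z : ℝ^m} (hz : z ∈ Ω) :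
    DifferentiableAt ℝ B z :=
  (h.contDiffOn_right.contDiffAt (h.isOpen.mem_nhds hz)).differentiableAt one_ne_zero

lemma inner_fderiv_right (h : IsFramePair A B Ω) {z : ℝ^m} (hz : z ∈ Ω) (x a : ℝ^m) (c : ℝ^n) :
    ⟪A z a, fderiv ℝ B z x c⟫_ℝ = -⟪fderiv ℝ A z x a, B z c⟫_ℝ := by
  have hA : HasFDerivAt (fun y ↦ A y a) ((fderiv ℝ A z).flip a) z := by
    simpa using (h.differentiableAt_left hz).hasFDerivAt.clm_apply (hasFDerivAt_const a z)
  have hB : HasFDerivAt (fun y ↦ B y c) ((fderiv ℝ B z).flip c) z := by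
    simpa using (h.differentiableAt_right hz).hasFDerivAt.clm_apply (hasFDerivAt_const c z)
  have hzero : (fun y ↦ ⟪A y a, B y c⟫_ℝ) =ᶠ[nhds z] fun _ ↦ 0 := by
    filter_upwards [h.isOpen.mem_nhds hz] with y hy using h.inner_eq_zero y hy a c
  have hderiv := DFunLike.congr_fun
    ((hA.inner ℝ hB).unique ((hasFDerivAt_const (0 : ℝ) z).congr_of_eventuallyEq hzero)) x
  simp only [ContinuousLinearMap.comp_apply, ContinuousLinearMap.prod_apply, fderivInnerCLM_apply,
    ContinuousLinearMap.flip_apply, zero_apply] at hderiv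
  linarith

lemma continuousOn_right_apply (h : IsFramePair A B Ω) :
    ContinuousOn (fun p : ℝ^m × ℝ^n ↦ B p.1 p.2) (Ω ×ˢ univ) :=
  (h.contDiffOn_right.continuousOn.comp continuousOn_fst fun _ hp ↦ hp.1).clm_apply
    continuousOn_snd

lemma hasFDerivAt_right_apply (h : IsFramePair A B Ω) {z : ℝ^m} (hz : z ∈ Ω) (c : ℝ^n) :
    HasFDerivAt (fun p : ℝ^m × ℝ^n ↦ B p.1 p.2)
      (((fderiv ℝ B z).flip c).coprod (B z)) (z, c) := by
  have hfst : HasFDerivAt (fun p : ℝ^m × ℝ^n ↦ B p.1)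
      (fderiv ℝ B z ∘L ContinuousLinearMap.fst ℝ _ _) (z, c) :=
    HasFDerivAt.comp (f := Prod.fst) (g := B) (z, c) (h.differentiableAt_right hz).hasFDerivAt
      hasFDerivAt_fst
  refine (hfst.clm_apply hasFDerivAt_snd).congr_fderiv ?_
  ext p <;> simp

lemma continuousOn_det_frameMatrix (h : IsFramePair A B Ω) :
    ContinuousOn (fun p : ℝ^m × ℝ^n ↦ (frameMatrix A p.1 (B p.1 p.2)).det) (Ω ×ˢ univ) := by
  have hderiv : ContinuousOn (fun p : ℝ^m × ℝ^n ↦ fderiv ℝ A p.1) (Ω ×ˢ univ) :=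
    (h.contDiffOn_left.continuousOn_fderiv_of_isOpen h.isOpen le_rfl).comp continuousOn_fst
      fun _ hp ↦ hp.1
  refine continuous_id.matrix_det.comp_continuousOn
    (continuousOn_pi.2 fun i ↦ continuousOn_pi.2 fun j ↦ ?_)
  exact ((hderiv.clm_apply continuousOn_const).clm_apply continuousOn_const).inner
    h.continuousOn_right_apply

lemma aemeasurable_det_frameMatrix (h : IsFramePair A B Ω) (hs : MeasurableSet s) (hsΩ : s ⊆ Ω) :
    AEMeasurable (fun p : ℝ^m × ℝ^n ↦ ENNReal.ofReal |(frameMatrix A p.1 (B p.1 p.2)).det|)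
      ((volume.restrict s).prod (volume.restrict (ball 0 1))) := by
  rw [Measure.prod_restrict]
  exact ENNReal.measurable_ofReal.comp_aemeasurable ((h.continuousOn_det_frameMatrix.abs.mono
    (prod_mono hsΩ (subset_univ _))).aemeasurable (hs.prod measurableSet_ball))

lemma lintegral_det_frameMatrix_lt_top (h : IsFramePair A B Ω) {C : Set (ℝ^m)} (hC : IsCompact C)
    (hCΩ : C ⊆ Ω) :
    ∫⁻ z in C, ∫⁻ c in ball 0 1, ENNReal.ofReal |(frameMatrix A z (B z c)).det| < ⊤ := by
  obtain ⟨M, hM⟩ := (hC.prod (isCompact_closedBall (0 : ℝ^n) 1)).bddAbove_image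
    (h.continuousOn_det_frameMatrix.abs.mono (prod_mono hCΩ (subset_univ _)))
  calc ∫⁻ z in C, ∫⁻ c in ball 0 1, ENNReal.ofReal |(frameMatrix A z (B z c)).det|
      ≤ ∫⁻ _ in C, ∫⁻ _ in ball (0 : ℝ^n) 1, ENNReal.ofReal M :=
        setLIntegral_mono' hC.measurableSet fun _ hz ↦
          setLIntegral_mono' measurableSet_ball fun _ hc ↦
            ENNReal.ofReal_le_ofReal (hM ⟨(_, _), ⟨hz, ball_subset_closedBall hc⟩, rfl⟩)
    _ < ⊤ := by
        simp only [setLIntegral_const]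
        exact ENNReal.mul_lt_top (ENNReal.mul_lt_top ENNReal.ofReal_lt_top measure_ball_lt_top)
          hC.measure_lt_top

lemma mem_ball_iff (h : IsFramePair A B Ω) {z : ℝ^m} (hz : z ∈ Ω) (c : ℝ^n) :
    B z c ∈ ball 0 1 ↔ c ∈ ball 0 1 := by
  rw [mem_ball_zero_iff, mem_ball_zero_iff, h.norm_right z hz]

lemma encard_fiber_right_apply (h : IsFramePair A B Ω) (hsΩ : s ⊆ Ω) :
    (fun v ↦ ({p ∈ s ×ˢ ball (0 : ℝ^n) 1 | B p.1 p.2 = v}.encard : ℝ≥0∞)) =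
      (ball 0 1).indicator fun v ↦ ({z ∈ s | v ∈ range (B z)}.encard : ℝ≥0∞) := by
  ext v
  by_cases hv : v ∈ ball 0 1
  · have himage : Prod.fst '' {p ∈ s ×ˢ ball (0 : ℝ^n) 1 | B p.1 p.2 = v} =
        {z ∈ s | v ∈ range (B z)} := by
      ext z
      constructor
      · rintro ⟨p, ⟨hp, hpv⟩, rfl⟩
        exact ⟨hp.1, p.2, hpv⟩
      · rintro ⟨hz, c, rfl⟩
        exact ⟨(z, c), ⟨⟨hz, (h.mem_ball_iff (hsΩ hz) c).1 hv⟩, rfl⟩, rfl⟩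
    have hinj : InjOn Prod.fst {p ∈ s ×ˢ ball (0 : ℝ^n) 1 | B p.1 p.2 = v} := by
      rintro ⟨z, c⟩ ⟨hz, hc⟩ ⟨z', c'⟩ ⟨-, hc'⟩ (rfl : z = z')
      have hBz : Function.Injective (B z) :=
        LinearIsometry.injective ⟨(B z).toLinearMap, h.norm_right z (hsΩ hz.1)⟩
      exact congrArg (Prod.mk z) (hBz (hc.trans hc'.symm))
    rw [indicator_of_mem hv, ← himage, hinj.encard_image]
  · have hempty : {p ∈ s ×ˢ ball (0 : ℝ^n) 1 | B p.1 p.2 = v} = ∅ :=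
      eq_empty_of_forall_notMem fun p ⟨hp, hpv⟩ ↦
        hv (hpv ▸ (h.mem_ball_iff (hsΩ hp.1) p.2).2 hp.2)
    rw [indicator_of_notMem hv, hempty, encard_empty, ENat.toENNReal_zero]

variable [FiniteDimensional ℝ E] [MeasurableSpace E] [BorelSpace E]

-- Differentiating `⟨A, B⟩ = 0` turns the derivative of `B` into the second fundamental form of `A`.
lemma abs_det_fderiv_right_apply (h : IsFramePair A B Ω) {L : E ≃L[ℝ] ℝ^m × ℝ^n}
    (hL : MeasurePreserving L) {z : ℝ^m} (hz : z ∈ Ω) (c : ℝ^n) :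
    |(fderiv ℝ (fun p : ℝ^m × ℝ^n ↦ B p.1 p.2) (z, c) ∘L L : E →L[ℝ] E).det| =
      |(frameMatrix A z (B z c)).det| := by
  have hmatrix : (Matrix.of fun i j ↦ ⟪A z (EuclideanSpace.single j 1),
      (fderiv ℝ B z).flip c (EuclideanSpace.single i 1)⟫_ℝ) = -frameMatrix A z (B z c) := by
    ext i j
    exact h.inner_fderiv_right hz _ _ c
  rw [(h.hasFDerivAt_right_apply hz c).fderiv,
    abs_det_comp_coprod_eq (by simpa using h.finrank_eq) (h.norm_left z hz) (h.norm_right z hz)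
      (h.inner_eq_zero z hz) hL, hmatrix, Matrix.det_neg, abs_mul, abs_pow, abs_neg, abs_one,
    one_pow, one_mul]

lemma aemeasurable_encard (h : IsFramePair A B Ω) (hs : MeasurableSet s) (hsΩ : s ⊆ Ω) :
    AEMeasurable (fun v ↦ ({z ∈ s | v ∈ range (B z)}.encard : ℝ≥0∞))
      ((volume : Measure E).restrict (ball 0 1)) := by
  obtain ⟨L, -⟩ := exists_measurePreserving_equiv_of_finrank_eq (E := E) (U := ℝ^m) (W := ℝ^n)
    (by simpa using h.finrank_eq)
  rw [← aemeasurable_indicator_iff measurableSet_ball, ← h.encard_fiber_right_apply hsΩ]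
  exact aemeasurable_encard_fiber_of_equiv volume L (hs.prod measurableSet_ball)
    fun p hp ↦ (h.hasFDerivAt_right_apply (hsΩ hp.1) p.2).differentiableAt

theorem lintegral_encard (h : IsFramePair A B Ω) (hs : MeasurableSet s) (hsΩ : s ⊆ Ω) :
    ∫⁻ v in ball (0 : E) 1, ({z ∈ s | v ∈ range (B z)}.encard : ℝ≥0∞) =
      ∫⁻ z in s, ∫⁻ c in ball 0 1, ENNReal.ofReal |(frameMatrix A z (B z c)).det| := by
  obtain ⟨L, hL⟩ := exists_measurePreserving_equiv_of_finrank_eq (E := E) (U := ℝ^m) (W := ℝ^n)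
    (by simpa using h.finrank_eq)
  have hsb : MeasurableSet (s ×ˢ ball (0 : ℝ^n) 1) := hs.prod measurableSet_ball
  rw [← lintegral_indicator measurableSet_ball, ← h.encard_fiber_right_apply hsΩ,
    lintegral_encard_fiber_of_measurePreserving volume hL hsb fun p hp ↦
      (h.hasFDerivAt_right_apply (hsΩ hp.1) p.2).differentiableAt,
    setLIntegral_congr_fun hsb fun p hp ↦ congrArg ENNReal.ofReal
      (h.abs_det_fderiv_right_apply hL (hsΩ hp.1) p.2),
    Measure.volume_eq_prod, ← Measure.prod_restrict,
    lintegral_prod _ (h.aemeasurable_det_frameMatrix hs hsΩ)]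

end IsFramePair

end Incidence

/-! ### Integrals of homogeneous functions over spheres and balls -/

section Polar

lemma lintegral_Iio_one_volumeIoiPow (n k : ℕ) :
    ∫⁻ r in Iio ⟨1, mem_Ioi.2 one_pos⟩, ENNReal.ofReal ((r : ℝ) ^ k) ∂Measure.volumeIoiPow n =
      ((n + k + 1 : ℕ) : ℝ≥0∞)⁻¹ := by
  have hIio : Measure.volumeIoiPow (n + k) (Iio ⟨1, mem_Ioi.2 one_pos⟩) =
      ((n + k + 1 : ℕ) : ℝ≥0∞)⁻¹ := by
    rw [Measure.volumeIoiPow_apply_Iio, one_pow, one_div,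
      ENNReal.ofReal_inv_of_pos (by positivity)]
    congr 1
    exact_mod_cast ENNReal.ofReal_natCast (n + k + 1)
  rw [← hIio, Measure.volumeIoiPow, Measure.volumeIoiPow, withDensity_apply _ measurableSet_Iio,
    restrict_withDensity measurableSet_Iio, lintegral_withDensity_eq_lintegral_mul]
  · refine lintegral_congr fun r ↦ ?_
    rw [Pi.mul_apply, ← ENNReal.ofReal_mul (pow_nonneg r.2.le _), pow_add]
  · fun_prop
  · fun_prop

variable {F : Type*} [NormedAddCommGroup F] [NormedSpace ℝ F] [FiniteDimensional ℝ F]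
  [MeasurableSpace F] [BorelSpace F]

lemma measurableEmbedding_polar :
    MeasurableEmbedding fun p : sphere (0 : F) 1 × Ioi (0 : ℝ) ↦ (p.2 : ℝ) • (p.1 : F) :=
  (MeasurableEmbedding.subtype_coe (measurableSet_singleton (0 : F)).compl).comp
    (homeomorphUnitSphereProd F).symm.measurableEmbedding

variable (μ : Measure F) [μ.IsAddHaarMeasure]

lemma measurePreserving_polar [Nontrivial F] :
    MeasurePreserving (fun p : sphere (0 : F) 1 × Ioi (0 : ℝ) ↦ (p.2 : ℝ) • (p.1 : F))
      (μ.toSphere.prod (Measure.volumeIoiPow (Module.finrank ℝ F - 1))) μ := by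
  have hval := measurePreserving_subtype_coe (μa := μ) (measurableSet_singleton (0 : F)).compl
  rw [restrict_compl_singleton] at hval
  exact hval.comp (μ.measurePreserving_homeomorphUnitSphereProd.symm
    (homeomorphUnitSphereProd F).toMeasurableEquiv)

lemma measurePreserving_polar_ball [Nontrivial F] :
    MeasurePreserving (fun p : sphere (0 : F) 1 × Ioi (0 : ℝ) ↦ (p.2 : ℝ) • (p.1 : F))
      (μ.toSphere.prod ((Measure.volumeIoiPow (Module.finrank ℝ F - 1)).restrict
        (Iio ⟨1, mem_Ioi.2 one_pos⟩))) (μ.restrict (ball 0 1)) := by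
  have hpre : (fun p : sphere (0 : F) 1 × Ioi (0 : ℝ) ↦ (p.2 : ℝ) • (p.1 : F)) ⁻¹' ball 0 1 =
      univ ×ˢ Iio ⟨1, mem_Ioi.2 one_pos⟩ := by
    ext ⟨v, r, hr⟩
    simp [norm_smul, abs_of_pos (mem_Ioi.1 hr), ← Subtype.coe_lt_coe]
  have h := (measurePreserving_polar μ).restrict_preimage_emb measurableEmbedding_polar (ball 0 1)
  rwa [hpre, ← Measure.prod_restrict, Measure.restrict_univ] at h

variable {μ} {g : F → ℝ≥0∞} {k : ℕ}

lemma aemeasurable_toSphere_of_homogeneous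
    (hom : ∀ r : ℝ, 0 < r → ∀ v, g (r • v) = ENNReal.ofReal (r ^ k) * g v)
    (hg : AEMeasurable g (μ.restrict (ball 0 1))) :
    AEMeasurable (fun v : sphere (0 : F) 1 ↦ g v) μ.toSphere := by
  rcases subsingleton_or_nontrivial F with hF | hF
  · simp [μ.toSphere_eq_zero_iff.2 hF]
  have hpolar := measurePreserving_polar_ball μ
  set ρ := (Measure.volumeIoiPow (Module.finrank ℝ F - 1)).restrict (Iio ⟨1, mem_Ioi.2 one_pos⟩)
    with hρ
  have hρ0 : ρ ≠ 0 := fun h ↦ by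
    have hone := lintegral_Iio_one_volumeIoiPow (Module.finrank ℝ F - 1) k
    rw [← hρ, h, lintegral_zero_measure] at hone
    exact ENNReal.inv_ne_zero.2 (ENNReal.natCast_ne_top _) hone.symm
  have hinv : AEMeasurable (fun p : sphere (0 : F) 1 × Ioi (0 : ℝ) ↦
      ENNReal.ofReal ((p.2 : ℝ)⁻¹ ^ k)) (μ.toSphere.prod ρ) := by fun_prop
  have hprod : AEMeasurable (fun p : sphere (0 : F) 1 × Ioi (0 : ℝ) ↦ g p.1)
      (μ.toSphere.prod ρ) := by
    refine (hinv.mul (hg.comp_quasiMeasurePreserving hpolar.quasiMeasurePreserving)).congr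
      (Filter.Eventually.of_forall fun p ↦ ?_)
    rw [Pi.mul_apply, Function.comp_apply, ← hom _ (inv_pos.2 p.2.2), smul_smul,
      inv_mul_cancel₀ (mem_Ioi.1 p.2.2).ne', one_smul]
  exact (AEStronglyMeasurable.of_comp_fst hprod.aestronglyMeasurable hρ0).aemeasurable

theorem lintegral_toSphere_of_homogeneous
    (hom : ∀ r : ℝ, 0 < r → ∀ v, g (r • v) = ENNReal.ofReal (r ^ k) * g v)
    (h0 : k ≠ 0 → g 0 = 0) (hg : AEMeasurable g (μ.restrict (ball 0 1))) :
    ∫⁻ v : sphere (0 : F) 1, g v ∂μ.toSphere =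
      ((Module.finrank ℝ F + k : ℕ) : ℝ≥0∞) * ∫⁻ v in ball 0 1, g v ∂μ := by
  rcases subsingleton_or_nontrivial F with hF | hF
  · rw [μ.toSphere_eq_zero_iff.2 hF, lintegral_zero_measure, Module.finrank_zero_of_subsingleton]
    rcases eq_or_ne k 0 with rfl | hk
    · simp
    · simp [Subsingleton.elim _ (0 : F), h0 hk]
  have hdim := Module.finrank_pos (R := ℝ) (M := F)
  have hball : ∫⁻ v in ball 0 1, g v ∂μ = (∫⁻ v : sphere (0 : F) 1, g v ∂μ.toSphere) *
      ((Module.finrank ℝ F + k : ℕ) : ℝ≥0∞)⁻¹ := by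
    rw [← (measurePreserving_polar_ball μ).lintegral_comp_emb measurableEmbedding_polar]
    simp only [hom _ (mem_Ioi.1 (Subtype.coe_prop _)), mul_comm (ENNReal.ofReal _)]
    rw [lintegral_prod_mul (g := fun r : Ioi (0 : ℝ) ↦ ENNReal.ofReal ((r : ℝ) ^ k))
      (aemeasurable_toSphere_of_homogeneous hom hg) (by fun_prop), lintegral_Iio_one_volumeIoiPow]
    congr 3
    omega
  have hne : ((Module.finrank ℝ F + k : ℕ) : ℝ≥0∞) ≠ 0 := by exact_mod_cast (by omega)
  rw [hball, mul_left_comm, ENNReal.mul_inv_cancel hne (ENNReal.natCast_ne_top _), mul_one]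

end Polar

/-! ### The Riemannian volume in charts -/

section Gram

variable {T : Type*} [NormedAddCommGroup T] [InnerProductSpace ℝ T] {m : ℕ}

lemma sqrt_det_gram_eq_abs_det (e : OrthonormalBasis (Fin m) ℝ T) (X : Fin m → T) :
    √(Matrix.gram ℝ X).det = |(Matrix.of fun i k ↦ ⟪X i, e k⟫_ℝ).det| := by
  have h : Matrix.gram ℝ X = (Matrix.of fun i k ↦ ⟪X i, e k⟫_ℝ) *
      (Matrix.of fun i k ↦ ⟪X i, e k⟫_ℝ).transpose := by
    ext i j
    rw [Matrix.gram_apply, ← e.sum_inner_mul_inner, Matrix.mul_apply]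
    simp [real_inner_comm]
  rw [h, Matrix.det_mul, Matrix.det_transpose, ← sq, Real.sqrt_sq_eq_abs]

lemma sqrt_det_gram_sum (e : OrthonormalBasis (Fin m) ℝ T) (C : Matrix (Fin m) (Fin m) ℝ)
    (X : Fin m → T) :
    √(Matrix.gram ℝ fun i ↦ ∑ k, C i k • X k).det = |C.det| * √(Matrix.gram ℝ X).det := by
  rw [sqrt_det_gram_eq_abs_det e, sqrt_det_gram_eq_abs_det e, ← abs_mul, ← Matrix.det_mul]
  congr 2
  ext i j
  simp [Matrix.mul_apply, sum_inner, inner_smul_left]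

end Gram

section ChartDeriv

variable {m : ℕ} {M : Type*} [TopologicalSpace M] [ChartedSpace (ℝ^m) M]

/-- The differential at `y` of the inverse of the chart at `x₀`. Its values on the standard basis
are the coordinate vectors `coordField x₀ y`. -/
noncomputable def chartDeriv (x₀ : M) (y : ℝ^m) :
    ℝ^m →L[ℝ] TangentSpace (𝓡 m) ((extChartAt (𝓡 m) x₀).symm y) :=
  mfderiv 𝓘(ℝ, ℝ^m) (𝓡 m) (extChartAt (𝓡 m) x₀).symm y

lemma chartDeriv_eq_sum_coordField (x₀ : M) (y w : ℝ^m) :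
    chartDeriv x₀ y w = ∑ i, w i • coordField x₀ y i := by
  conv_lhs => rw [← (EuclideanSpace.basisFun (Fin m) ℝ).sum_repr w]
  rw [map_sum]
  refine Finset.sum_congr rfl fun i _ ↦ ?_
  rw [map_smul, EuclideanSpace.basisFun_repr, EuclideanSpace.basisFun_apply]
  rfl

variable [IsManifold (𝓡 m) ∞ M] {x₀ x₁ : M} {y : ℝ^m}

lemma mdifferentiableAt_extChartAt_symm (hy : y ∈ (extChartAt (𝓡 m) x₀).target) :
    MDifferentiableAt 𝓘(ℝ, ℝ^m) (𝓡 m) (extChartAt (𝓡 m) x₀).symm y :=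
  ((contMDiffOn_extChartAt_symm (I := 𝓡 m) (n := ∞) x₀).contMDiffAt
    ((isOpen_extChartAt_target x₀).mem_nhds hy)).mdifferentiableAt (by simp)

lemma bijective_chartDeriv (hy : y ∈ (extChartAt (𝓡 m) x₀).target) :
    Function.Bijective (chartDeriv x₀ y) := by
  have h := isInvertible_mfderivWithin_extChartAt_symm (I := 𝓡 m) hy
  rw [ModelWithCorners.range_eq_univ, mfderivWithin_univ] at h
  exact h.bijective

lemma linearIndependent_coordField (hy : y ∈ (extChartAt (𝓡 m) x₀).target) :
    LinearIndependent ℝ (coordField x₀ y) := by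
  have h := (EuclideanSpace.basisFun (Fin m) ℝ).toBasis.linearIndependent.map'
    (chartDeriv x₀ y).toLinearMap (LinearMap.ker_eq_bot.2 (bijective_chartDeriv hy).1)
  convert! h using 1
  ext1 i
  rw [Function.comp_apply, OrthonormalBasis.coe_toBasis, EuclideanSpace.basisFun_apply]
  rfl

lemma differentiableAt_extChartAt_comp_symm (hy : y ∈ (extChartAt (𝓡 m) x₀).target)
    (hy₁ : (extChartAt (𝓡 m) x₀).symm y ∈ (extChartAt (𝓡 m) x₁).source) :
    DifferentiableAt ℝ (extChartAt (𝓡 m) x₁ ∘ (extChartAt (𝓡 m) x₀).symm) y := by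
  rw [← mdifferentiableAt_iff_differentiableAt]
  rw [extChartAt_source] at hy₁
  exact (mdifferentiableAt_extChartAt hy₁).comp y (mdifferentiableAt_extChartAt_symm hy)

-- Both sides are read in the model space `ℝ^m`, as their tangent spaces are those at the equal,
-- but not definitionally equal, points `φ₀⁻¹ y` and `φ₁⁻¹ (φ₁ (φ₀⁻¹ y))`.
lemma chartDeriv_eq_chartDeriv_fderiv (hy : y ∈ (extChartAt (𝓡 m) x₀).target)
    (hy₁ : (extChartAt (𝓡 m) x₀).symm y ∈ (extChartAt (𝓡 m) x₁).source) (w : ℝ^m) :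
    (chartDeriv x₀ y w : ℝ^m) =
      (chartDeriv x₁ (extChartAt (𝓡 m) x₁ ((extChartAt (𝓡 m) x₀).symm y))
        (fderiv ℝ (extChartAt (𝓡 m) x₁ ∘ (extChartAt (𝓡 m) x₀).symm) y w) : ℝ^m) := by
  set φ₀ := extChartAt (𝓡 m) x₀
  set φ₁ := extChartAt (𝓡 m) x₁
  have hev : φ₁.symm ∘ (φ₁ ∘ φ₀.symm) =ᶠ[nhds y] φ₀.symm := by
    filter_upwards [(mdifferentiableAt_extChartAt_symm hy).continuousAt
      ((isOpen_extChartAt_source x₁).mem_nhds hy₁)] with z hz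
    exact φ₁.left_inv hz
  have htransition : MDifferentiableAt 𝓘(ℝ, ℝ^m) 𝓘(ℝ, ℝ^m) (φ₁ ∘ φ₀.symm) y :=
    mdifferentiableAt_iff_differentiableAt.2 (differentiableAt_extChartAt_comp_symm hy hy₁)
  have hsymm : MDifferentiableAt 𝓘(ℝ, ℝ^m) (𝓡 m) φ₁.symm ((φ₁ ∘ φ₀.symm) y) :=
    mdifferentiableAt_extChartAt_symm (φ₁.map_source hy₁)
  have hchain := mfderiv_comp y hsymm htransition
  rw [mfderiv_eq_fderiv] at hchain
  exact (DFunLike.congr_fun (hev.mfderiv_eq (I := 𝓘(ℝ, ℝ^m)) (I' := 𝓡 m)) w).symm.trans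
    (DFunLike.congr_fun hchain w)

lemma continuousOn_coordField (x₀ : M) (i : Fin m) :
    ContinuousOn (fun y ↦ (⟨(extChartAt (𝓡 m) x₀).symm y, coordField x₀ y i⟩ :
      TotalSpace (ℝ^m) (fun x : M ↦ TangentSpace (𝓡 m) x))) (extChartAt (𝓡 m) x₀).target := by
  have hopen := isOpen_extChartAt_target (I := 𝓡 m) x₀
  have htangent := (contMDiffOn_extChartAt_symm (I := 𝓡 m) (n := ∞)
    x₀).continuousOn_tangentMapWithin (by simp) hopen.uniqueMDiffOn
  have hconst : Continuous (fun y : ℝ^m ↦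
      (⟨y, EuclideanSpace.single i 1⟩ : TangentBundle 𝓘(ℝ, ℝ^m) (ℝ^m))) :=
    (tangentBundleModelSpaceHomeomorph 𝓘(ℝ, ℝ^m)).symm.continuous.comp
      (continuous_id.prodMk continuous_const)
  refine (htangent.comp hconst.continuousOn fun y hy ↦ hy).congr fun y hy ↦ ?_
  simp only [Function.comp_apply, tangentMapWithin, coordField]
  rw [mfderivWithin_of_isOpen hopen hy]

end ChartDeriv

section VolumeDensity

variable {m : ℕ} {M : Type*} [TopologicalSpace M] [ChartedSpace (ℝ^m) M]
  [IsManifold (𝓡 m) ∞ M] [RiemannianBundle (fun x : M ↦ TangentSpace (𝓡 m) x)]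
  {x₀ x₁ : M} {y : ℝ^m}

/-- An orthonormal basis of the tangent space, indexed by `Fin m`; it is the one that enters the
definition of `absDetShape`. -/
noncomputable def tangentBasis (x : M) : OrthonormalBasis (Fin m) ℝ (TangentSpace (𝓡 m) x) :=
  (stdOrthonormalBasis ℝ (TangentSpace (𝓡 m) x)).reindex (finCongr (finrank_tangentSpace_eq x))

lemma volumeDensity_eq_abs_det_mul (hy : y ∈ (extChartAt (𝓡 m) x₀).target)
    (hy₁ : (extChartAt (𝓡 m) x₀).symm y ∈ (extChartAt (𝓡 m) x₁).source) :
    volumeDensity x₀ y =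
      |(fderiv ℝ (extChartAt (𝓡 m) x₁ ∘ (extChartAt (𝓡 m) x₀).symm) y).det| *
        volumeDensity x₁ (extChartAt (𝓡 m) x₁ ((extChartAt (𝓡 m) x₀).symm y)) := by
  set φ₀ := extChartAt (𝓡 m) x₀
  set φ₁ := extChartAt (𝓡 m) x₁
  set τ' := fderiv ℝ (φ₁ ∘ φ₀.symm) y
  have hgram : ∀ p q : M, p = q → ∀ (X : Fin m → TangentSpace (𝓡 m) p)
      (Y : Fin m → TangentSpace (𝓡 m) q), (∀ i, (X i : ℝ^m) = Y i) →
      √(Matrix.gram ℝ X).det = √(Matrix.gram ℝ Y).det := by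
    rintro p _ rfl X Y h
    obtain rfl : X = Y := funext h
    rfl
  let C : Matrix (Fin m) (Fin m) ℝ := Matrix.of fun i k ↦ τ' (EuclideanSpace.single i 1) k
  have hC : C.det = τ'.det := by
    rw [ContinuousLinearMap.det,
      ← LinearMap.det_toMatrix (EuclideanSpace.basisFun (Fin m) ℝ).toBasis, ← Matrix.det_transpose]
    congr 1
  rw [← hC]
  refine Eq.trans ?_ (sqrt_det_gram_sum (tangentBasis (φ₁.symm (φ₁ (φ₀.symm y)))) C
    (coordField x₁ (φ₁ (φ₀.symm y))))
  exact hgram _ _ (φ₁.left_inv hy₁).symm _ _ fun i ↦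
    (chartDeriv_eq_chartDeriv_fderiv hy hy₁ _).trans (chartDeriv_eq_sum_coordField _ _ _)

lemma volumeDensity_pos (hy : y ∈ (extChartAt (𝓡 m) x₀).target) : 0 < volumeDensity x₀ y := by
  refine Real.sqrt_pos.2 (Matrix.PosDef.det_pos ?_)
  exact Matrix.posDef_gram_of_linearIndependent (linearIndependent_coordField hy)

lemma continuousOn_volumeDensity
    [IsContinuousRiemannianBundle (ℝ^m) (fun x : M ↦ TangentSpace (𝓡 m) x)] (x₀ : M) :
    ContinuousOn (volumeDensity x₀) (extChartAt (𝓡 m) x₀).target := by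
  have hgram : ContinuousOn (fun y ↦ Matrix.gram ℝ (coordField x₀ y))
      (extChartAt (𝓡 m) x₀).target :=
    continuousOn_pi.2 fun i ↦ continuousOn_pi.2 fun j ↦
      (continuousOn_coordField x₀ i).inner_bundle (continuousOn_coordField x₀ j)
  exact Real.continuous_sqrt.comp_continuousOn (continuous_id.matrix_det.comp_continuousOn hgram)

end VolumeDensity

section RiemannianVolume

lemma measurableSet_inter_preimage_of_continuousOn {α β : Type*} [TopologicalSpace α]
    [MeasurableSpace α] [OpensMeasurableSpace α] [TopologicalSpace β] [MeasurableSpace β]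
    [BorelSpace β] {f : α → β} {s : Set α} (hf : ContinuousOn f s) (hs : MeasurableSet s)
    {t : Set β} (ht : MeasurableSet t) : MeasurableSet (s ∩ f ⁻¹' t) := by
  have h := hs.subtype_image ((continuousOn_iff_continuous_domRestrict.1 hf).measurable ht)
  convert! h using 1
  ext x
  simp [and_comm]

variable {m : ℕ} {M : Type*} [TopologicalSpace M] [ChartedSpace (ℝ^m) M]
  [MeasurableSpace M]

lemma comp_symm_comp_extChartAt_ae_eq {x₀ : M} {A : Set M} (hA : MeasurableSet A)
    (hA₀ : A ⊆ (extChartAt (𝓡 m) x₀).source) {β : Type*} (g : M → β) (μ : Measure M) :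
    (fun y ↦ g ((extChartAt (𝓡 m) x₀).symm y)) ∘ extChartAt (𝓡 m) x₀ =ᵐ[μ.restrict A] g := by
  filter_upwards [ae_restrict_mem hA] with x hx
  rw [Function.comp_apply, (extChartAt (𝓡 m) x₀).left_inv (hA₀ hx)]

variable [BorelSpace M]

lemma measurableSet_target_inter_preimage (x₀ : M) {A : Set M} (hA : MeasurableSet A) :
    MeasurableSet ((extChartAt (𝓡 m) x₀).target ∩ (extChartAt (𝓡 m) x₀).symm ⁻¹' A) :=
  measurableSet_inter_preimage_of_continuousOn (continuousOn_extChartAt_symm x₀)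
    (isOpen_extChartAt_target x₀).measurableSet hA

variable [RiemannianBundle (fun x : M ↦ TangentSpace (𝓡 m) x)]

lemma chartVolume_apply (x₀ : M) {A : Set M} (hA : MeasurableSet A) :
    chartVolume (m := m) x₀ A =
      ∫⁻ y in (extChartAt (𝓡 m) x₀).target ∩ (extChartAt (𝓡 m) x₀).symm ⁻¹' A,
        ENNReal.ofReal (volumeDensity x₀ y) := by
  set φ := extChartAt (𝓡 m) x₀
  have htarget : MeasurableSet φ.target := (isOpen_extChartAt_target x₀).measurableSet
  have hpre := measurableSet_target_inter_preimage (m := m) x₀ hA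
  set μ := (volume.restrict φ.target).withDensity fun y ↦ ENNReal.ofReal (volumeDensity x₀ y)
  have hac : μ ≪ volume.restrict φ.target := withDensity_absolutelyContinuous _ _
  have hsymm : AEMeasurable φ.symm μ :=
    ((continuousOn_extChartAt_symm x₀).aemeasurable htarget).mono_ac hac
  have hae : φ.symm ⁻¹' A =ᵐ[μ] (φ.target ∩ φ.symm ⁻¹' A : Set (ℝ^m)) := by
    filter_upwards [hac.ae_le (ae_restrict_mem htarget)] with y hy
    exact propext ⟨fun h ↦ ⟨hy, h⟩, fun h ↦ h.2⟩
  rw [chartVolume, Measure.map_apply_of_aemeasurable hsymm hA, measure_congr hae,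
    withDensity_apply _ hpre, Measure.restrict_restrict hpre, inter_assoc, inter_comm,
    inter_assoc, inter_self, inter_comm]

variable [IsManifold (𝓡 m) ∞ M]

lemma chartVolume_le (x₀ x₁ : M) {A : Set M} (hA : MeasurableSet A)
    (hA₀ : A ⊆ (extChartAt (𝓡 m) x₀).source) :
    chartVolume (m := m) x₁ A ≤ chartVolume (m := m) x₀ A := by
  rw [chartVolume_apply x₁ hA, chartVolume_apply x₀ hA]
  set φ₀ := extChartAt (𝓡 m) x₀
  set φ₁ := extChartAt (𝓡 m) x₁
  set s := φ₁.target ∩ φ₁.symm ⁻¹' A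
  have hs : MeasurableSet s := measurableSet_target_inter_preimage (m := m) x₁ hA
  have hinj : InjOn (φ₀ ∘ φ₁.symm) s := fun y hy z hz h ↦
    φ₁.symm.injOn hy.1 hz.1 (φ₀.injOn (hA₀ hy.2) (hA₀ hz.2) h)
  have hderiv : ∀ y ∈ s, HasFDerivWithinAt (φ₀ ∘ φ₁.symm) (fderiv ℝ (φ₀ ∘ φ₁.symm) y) s y :=
    fun y hy ↦ (differentiableAt_extChartAt_comp_symm hy.1
      (hA₀ hy.2)).hasFDerivAt.hasFDerivWithinAt
  calc ∫⁻ y in s, ENNReal.ofReal (volumeDensity x₁ y)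
      = ∫⁻ y in s, ENNReal.ofReal |(fderiv ℝ (φ₀ ∘ φ₁.symm) y).det| *
          ENNReal.ofReal (volumeDensity x₀ ((φ₀ ∘ φ₁.symm) y)) := by
        refine setLIntegral_congr_fun hs fun y hy ↦ ?_
        rw [volumeDensity_eq_abs_det_mul hy.1 (hA₀ hy.2), ENNReal.ofReal_mul (abs_nonneg _)]
        rfl
    _ = ∫⁻ y in (φ₀ ∘ φ₁.symm) '' s, ENNReal.ofReal (volumeDensity x₀ y) :=
        (lintegral_image_eq_lintegral_abs_det_fderiv_mul volume hs hderiv hinj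
          fun y ↦ ENNReal.ofReal (volumeDensity x₀ y)).symm
    _ ≤ ∫⁻ y in φ₀.target ∩ φ₀.symm ⁻¹' A, ENNReal.ofReal (volumeDensity x₀ y) := by
        refine lintegral_mono_set ?_
        rintro _ ⟨y, hy, rfl⟩
        refine ⟨φ₀.map_source (hA₀ hy.2), ?_⟩
        rw [mem_preimage, Function.comp_apply, φ₀.left_inv (hA₀ hy.2)]
        exact hy.2

lemma riemannianVolume_apply_of_subset_source (x₀ : M) {A : Set M} (hA : MeasurableSet A)
    (hA₀ : A ⊆ (extChartAt (𝓡 m) x₀).source) :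
    riemannianVolume m M A = chartVolume (m := m) x₀ A := by
  have hchart : ∀ x₁ : M, chartVolume (m := m) x₁ ≤ riemannianVolume m M := fun x₁ ↦
    le_iSup (fun x₀ : M ↦ chartVolume (m := m) x₀) x₁
  refine le_antisymm ?_ (Measure.le_iff'.1 (hchart x₀) A)
  set S := (extChartAt (𝓡 m) x₀).source
  have hS : MeasurableSet S := (isOpen_extChartAt_source x₀).measurableSet
  have hle : riemannianVolume m M ≤
      chartVolume (m := m) x₀ + (riemannianVolume m M).restrict Sᶜ := by
    refine iSup_le fun x₁ ↦ Measure.le_iff.2 fun B hB ↦ ?_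
    rw [Measure.add_apply, Measure.restrict_apply hB, ← measure_inter_add_sdiff B hS]
    exact add_le_add ((chartVolume_le x₀ x₁ (hB.inter hS) inter_subset_right).trans
      (measure_mono inter_subset_left)) (Measure.le_iff'.1 (hchart x₁) _)
  refine (Measure.le_iff'.1 hle A).trans_eq ?_
  rw [Measure.add_apply, Measure.restrict_apply hA,
    disjoint_iff_inter_eq_empty.1 (disjoint_compl_right_iff_subset.2 hA₀), measure_empty, add_zero]

variable {x₀ : M} {A : Set M}

lemma map_extChartAt_riemannianVolume (hA : MeasurableSet A)
    (hA₀ : A ⊆ (extChartAt (𝓡 m) x₀).source) :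
    ((riemannianVolume m M).restrict A).map (extChartAt (𝓡 m) x₀) =
      (volume.restrict ((extChartAt (𝓡 m) x₀).target ∩
        (extChartAt (𝓡 m) x₀).symm ⁻¹' A)).withDensity
        fun y ↦ ENNReal.ofReal (volumeDensity x₀ y) := by
  set φ := extChartAt (𝓡 m) x₀
  have hcont : ContinuousOn φ A := (continuousOn_extChartAt x₀).mono hA₀
  have hφ : AEMeasurable φ ((riemannianVolume m M).restrict A) := hcont.aemeasurable hA
  ext B hB
  have hAB : MeasurableSet (A ∩ φ ⁻¹' B) :=
    measurableSet_inter_preimage_of_continuousOn hcont hA hB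
  rw [Measure.map_apply_of_aemeasurable hφ hB, Measure.restrict_apply₀ (hφ.nullMeasurable hB),
    inter_comm, riemannianVolume_apply_of_subset_source x₀ hAB (inter_subset_left.trans hA₀),
    chartVolume_apply x₀ hAB, withDensity_apply _ hB, Measure.restrict_restrict hB]
  congr 2
  ext y
  constructor
  · rintro ⟨hy, hyA, hyB⟩
    exact ⟨(congrArg (· ∈ B) (φ.right_inv hy)).mp hyB, hy, hyA⟩
  · rintro ⟨hyB, hy, hyA⟩
    exact ⟨hy, hyA, (congrArg (· ∈ B) (φ.right_inv hy)).mpr hyB⟩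

variable {g : M → ℝ≥0∞}

lemma aemeasurable_comp_symm_map (hA : MeasurableSet A)
    (hA₀ : A ⊆ (extChartAt (𝓡 m) x₀).source)
    (hg : AEMeasurable (fun y ↦ g ((extChartAt (𝓡 m) x₀).symm y)) (volume.restrict
      ((extChartAt (𝓡 m) x₀).target ∩ (extChartAt (𝓡 m) x₀).symm ⁻¹' A))) :
    AEMeasurable (fun y ↦ g ((extChartAt (𝓡 m) x₀).symm y))
      (((riemannianVolume m M).restrict A).map (extChartAt (𝓡 m) x₀)) := by
  rw [map_extChartAt_riemannianVolume hA hA₀]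
  exact hg.mono_ac (withDensity_absolutelyContinuous _ _)

lemma aemeasurable_riemannianVolume_of_comp_symm (hA : MeasurableSet A)
    (hA₀ : A ⊆ (extChartAt (𝓡 m) x₀).source)
    (hg : AEMeasurable (fun y ↦ g ((extChartAt (𝓡 m) x₀).symm y)) (volume.restrict
      ((extChartAt (𝓡 m) x₀).target ∩ (extChartAt (𝓡 m) x₀).symm ⁻¹' A))) :
    AEMeasurable g ((riemannianVolume m M).restrict A) :=
  ((aemeasurable_comp_symm_map hA hA₀ hg).comp_aemeasurable
    (((continuousOn_extChartAt x₀).mono hA₀).aemeasurable hA)).congr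
    (comp_symm_comp_extChartAt_ae_eq hA hA₀ g _)

variable [IsContinuousRiemannianBundle (ℝ^m) (fun x : M ↦ TangentSpace (𝓡 m) x)]

lemma aemeasurable_volumeDensity (hA : MeasurableSet A) :
    AEMeasurable (fun y ↦ ENNReal.ofReal (volumeDensity x₀ y)) (volume.restrict
      ((extChartAt (𝓡 m) x₀).target ∩ (extChartAt (𝓡 m) x₀).symm ⁻¹' A)) :=
  ENNReal.measurable_ofReal.comp_aemeasurable
    (((continuousOn_volumeDensity x₀).mono inter_subset_left).aemeasurable
      (measurableSet_target_inter_preimage x₀ hA))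

lemma aemeasurable_comp_symm_of_volumeDensity_mul (hA : MeasurableSet A)
    (hg : AEMeasurable
      (fun y ↦ ENNReal.ofReal (volumeDensity x₀ y) * g ((extChartAt (𝓡 m) x₀).symm y))
      (volume.restrict
        ((extChartAt (𝓡 m) x₀).target ∩ (extChartAt (𝓡 m) x₀).symm ⁻¹' A))) :
    AEMeasurable (fun y ↦ g ((extChartAt (𝓡 m) x₀).symm y)) (volume.restrict
      ((extChartAt (𝓡 m) x₀).target ∩ (extChartAt (𝓡 m) x₀).symm ⁻¹' A)) := by
  refine ((aemeasurable_volumeDensity hA).inv.mul hg).congr ?_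
  filter_upwards [ae_restrict_mem (measurableSet_target_inter_preimage x₀ hA)] with y hy
  rw [Pi.mul_apply, Pi.inv_apply, ← mul_assoc, ENNReal.inv_mul_cancel
    (ENNReal.ofReal_pos.2 (volumeDensity_pos hy.1)).ne' ENNReal.ofReal_ne_top, one_mul]

theorem setLIntegral_riemannianVolume (hA : MeasurableSet A)
    (hA₀ : A ⊆ (extChartAt (𝓡 m) x₀).source)
    (hg : AEMeasurable (fun y ↦ g ((extChartAt (𝓡 m) x₀).symm y)) (volume.restrict
      ((extChartAt (𝓡 m) x₀).target ∩ (extChartAt (𝓡 m) x₀).symm ⁻¹' A))) :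
    ∫⁻ x in A, g x ∂riemannianVolume m M =
      ∫⁻ y in (extChartAt (𝓡 m) x₀).target ∩ (extChartAt (𝓡 m) x₀).symm ⁻¹' A,
        ENNReal.ofReal (volumeDensity x₀ y) * g ((extChartAt (𝓡 m) x₀).symm y) := by
  rw [← lintegral_congr_ae (comp_symm_comp_extChartAt_ae_eq hA hA₀ g _)]
  simp only [Function.comp_apply]
  rw [← lintegral_map' (aemeasurable_comp_symm_map hA hA₀ hg)
    (((continuousOn_extChartAt x₀).mono hA₀).aemeasurable hA),
    map_extChartAt_riemannianVolume hA hA₀,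
    lintegral_withDensity_eq_lintegral_mul₀ (aemeasurable_volumeDensity hA) hg]
  rfl

end RiemannianVolume

/-! ### The critical spaces and the shape operator in charts -/

section EvalVector

variable {m : ℕ} {M : Type*} [TopologicalSpace M] [ChartedSpace (ℝ^m) M]
  {E : Type*} [NormedAddCommGroup E] [InnerProductSpace ℝ E] [FiniteDimensional ℝ E]

/-- The vector of `E` that represents the evaluation `v ↦ ι v x`. The map `x ↦ evalVector ι x` is
smooth, and the spaces `K_x^⊥` are the ranges of its differentials. -/
noncomputable def evalVector (ι : E →ₗ[ℝ] C^∞⟮𝓡 m, M; ℝ⟯) (x : M) : E :=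
  ∑ a, ι (stdOrthonormalBasis ℝ E a) x • stdOrthonormalBasis ℝ E a

lemma inner_evalVector (ι : E →ₗ[ℝ] C^∞⟮𝓡 m, M; ℝ⟯) (v : E) (x : M) :
    ⟪v, evalVector ι x⟫_ℝ = ι v x := by
  let evalAt : E →ₗ[ℝ] ℝ :=
    { toFun := fun v ↦ ι v x
      map_add' := fun v w ↦ by rw [map_add, ContMDiffMap.coe_add, Pi.add_apply]
      map_smul' := fun c v ↦ by rw [map_smul, ContMDiffMap.coe_smul, Pi.smul_apply]; rfl }
  calc ⟪v, evalVector ι x⟫_ℝ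
      = ∑ a, ⟪stdOrthonormalBasis ℝ E a, v⟫_ℝ * evalAt (stdOrthonormalBasis ℝ E a) := by
        rw [evalVector, inner_sum]
        refine Finset.sum_congr rfl fun a _ ↦ ?_
        rw [inner_smul_right, mul_comm, real_inner_comm]
        rfl
    _ = evalAt (∑ a, ⟪stdOrthonormalBasis ℝ E a, v⟫_ℝ • stdOrthonormalBasis ℝ E a) := by
        simp only [map_sum, map_smul, smul_eq_mul]
    _ = ι v x := by rw [(stdOrthonormalBasis ℝ E).sum_repr' v]; rfl

lemma contMDiff_evalVector (ι : E →ₗ[ℝ] C^∞⟮𝓡 m, M; ℝ⟯) :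
    ContMDiff (𝓡 m) 𝓘(ℝ, E) ∞ (evalVector ι) :=
  ContMDiff.sum fun a _ ↦ (ι (stdOrthonormalBasis ℝ E a)).contMDiff.smul contMDiff_const

lemma mdifferentiable_evalVector (ι : E →ₗ[ℝ] C^∞⟮𝓡 m, M; ℝ⟯) :
    MDifferentiable (𝓡 m) 𝓘(ℝ, E) (evalVector ι) :=
  (contMDiff_evalVector ι).mdifferentiable (by simp)

lemma inner_mvfderiv_evalVector (ι : E →ₗ[ℝ] C^∞⟮𝓡 m, M; ℝ⟯) (x : M) (v : E)
    (X : TangentSpace (𝓡 m) x) :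
    ⟪v, mvfderiv (𝓡 m) (evalVector ι) x X⟫_ℝ = adjunction ι x v X := by
  have hcomp : innerSL ℝ v ∘ evalVector ι = ι v := funext (inner_evalVector ι v)
  have hchain := mfderiv_comp_apply x (innerSL ℝ v).mdifferentiableAt
    (mdifferentiable_evalVector ι x) X
  rw [hcomp, (innerSL ℝ v).mfderiv_eq] at hchain
  exact hchain.symm

lemma criticalSpace_eq_orthogonal_range (ι : E →ₗ[ℝ] C^∞⟮𝓡 m, M; ℝ⟯) (x : M) :
    criticalSpace ι x = (mvfderiv (𝓡 m) (evalVector ι) x).rangeᗮ := by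
  ext v
  rw [Submodule.mem_orthogonal']
  constructor
  · rintro hv _ ⟨X, rfl⟩
    exact (inner_mvfderiv_evalVector ι x v X).trans (DFunLike.congr_fun (LinearMap.mem_ker.1 hv) X)
  · exact fun hv ↦ LinearMap.mem_ker.2 (ContinuousLinearMap.ext fun X ↦
      (inner_mvfderiv_evalVector ι x v X).symm.trans (hv _ ⟨X, rfl⟩))

lemma orthogonal_criticalSpace_eq_range (ι : E →ₗ[ℝ] C^∞⟮𝓡 m, M; ℝ⟯) (x : M) :
    (criticalSpace ι x)ᗮ = (mvfderiv (𝓡 m) (evalVector ι) x).range := by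
  rw [criticalSpace_eq_orthogonal_range, Submodule.orthogonal_orthogonal]

variable {ι : E →ₗ[ℝ] C^∞⟮𝓡 m, M; ℝ⟯}

lemma IsAmple.finrank_criticalSpace_add (hι : IsAmple ι) (x : M) :
    Module.finrank ℝ (criticalSpace ι x) + m = Module.finrank ℝ E := by
  have h := (criticalSpace ι x).finrank_add_finrank_orthogonal
  rwa [hι.finrank_orthogonal x] at h

lemma IsAmple.injective_mvfderiv_evalVector (hι : IsAmple ι) (x : M) :
    Function.Injective (mvfderiv (𝓡 m) (evalVector ι) x) := by
  have hrange := hι.finrank_orthogonal x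
  rw [orthogonal_criticalSpace_eq_range] at hrange
  have hnullity := (mvfderiv (𝓡 m) (evalVector ι) x).toLinearMap.finrank_range_add_finrank_ker
  rw [hrange, finrank_tangentSpace_eq] at hnullity
  exact LinearMap.ker_eq_bot.1 (Submodule.finrank_eq_zero.1 (by omega))

end EvalVector

section CriticalFrame

variable {m n : ℕ} {M : Type*} [TopologicalSpace M] [ChartedSpace (ℝ^m) M]
  {E : Type*} [NormedAddCommGroup E] [InnerProductSpace ℝ E]

lemma fderiv_comp_extChartAt_symm [IsManifold (𝓡 m) ∞ M] {f : M → E} {x₀ : M} {z : ℝ^m}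
    (hz : z ∈ (extChartAt (𝓡 m) x₀).target)
    (hf : MDifferentiableAt (𝓡 m) 𝓘(ℝ, E) f ((extChartAt (𝓡 m) x₀).symm z)) (w : ℝ^m) :
    fderiv ℝ (f ∘ (extChartAt (𝓡 m) x₀).symm) z w =
      mvfderiv (𝓡 m) f ((extChartAt (𝓡 m) x₀).symm z) (chartDeriv x₀ z w) := by
  have h := mfderiv_comp_apply z hf (mdifferentiableAt_extChartAt_symm hz) w
  rw [mfderiv_eq_fderiv] at h
  exact h

variable [FiniteDimensional ℝ E] {ι : E →ₗ[ℝ] C^∞⟮𝓡 m, M; ℝ⟯}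

lemma IsFramePair.range_right_eq_orthogonal {X : Type*} [NormedAddCommGroup X] [NormedSpace ℝ X]
    {A : X → ℝ^m →L[ℝ] E} {B : X → ℝ^n →L[ℝ] E} {Ω : Set X} (h : IsFramePair A B Ω) {z : X}
    (hz : z ∈ Ω) : (B z).range = ((A z).range)ᗮ := by
  refine Submodule.eq_of_le_of_finrank_eq ?_ ?_
  · rintro _ ⟨c, rfl⟩
    refine (Submodule.mem_orthogonal _ _).2 ?_
    rintro _ ⟨a, rfl⟩
    exact h.inner_eq_zero z hz a c
  · have hA : Function.Injective (A z).toLinearMap :=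
      (LinearIsometry.mk (A z).toLinearMap (h.norm_left z hz)).injective
    have hB : Function.Injective (B z).toLinearMap :=
      (LinearIsometry.mk (B z).toLinearMap (h.norm_right z hz)).injective
    have hsum := (A z).range.finrank_add_finrank_orthogonal
    rw [LinearMap.finrank_range_of_inj hA, h.finrank_eq, finrank_euclideanSpace_fin] at hsum
    rw [LinearMap.finrank_range_of_inj hB, finrank_euclideanSpace_fin]
    omega

/-- A pair of frames over an open set of coordinates in the chart at `x₀`: `A` is an orthonormal
frame of the bundle `K^⊥`, and hence `B` is one of the bundle `K` of critical spaces. -/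
structure IsCriticalFrame (ι : E →ₗ[ℝ] C^∞⟮𝓡 m, M; ℝ⟯) (x₀ : M) (A : ℝ^m → ℝ^m →L[ℝ] E)
    (B : ℝ^m → ℝ^n →L[ℝ] E) (Ω : Set (ℝ^m)) : Prop extends IsFramePair A B Ω where
  subset_target : Ω ⊆ (extChartAt (𝓡 m) x₀).target
  range_left : ∀ z ∈ Ω, (A z).range = (criticalSpace ι ((extChartAt (𝓡 m) x₀).symm z))ᗮ

variable {x₀ : M} {A : ℝ^m → ℝ^m →L[ℝ] E} {B : ℝ^m → ℝ^n →L[ℝ] E} {Ω : Set (ℝ^m)} {z : ℝ^m}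

lemma IsCriticalFrame.range_right (h : IsCriticalFrame ι x₀ A B Ω) (hz : z ∈ Ω) :
    (B z).range = criticalSpace ι ((extChartAt (𝓡 m) x₀).symm z) := by
  rw [h.range_right_eq_orthogonal hz, h.range_left z hz, Submodule.orthogonal_orthogonal]

lemma exists_linearIsometryEquiv_of_range_eq {U E : Type*} [NormedAddCommGroup U]
    [InnerProductSpace ℝ U] [NormedAddCommGroup E] [InnerProductSpace ℝ E] {f : U →L[ℝ] E}
    (hf : ∀ x, ‖f x‖ = ‖x‖) {K : Submodule ℝ E} (hK : f.range = K) :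
    ∃ L : U ≃ₗᵢ[ℝ] K, ∀ x, (L x : E) = f x := by
  subst hK
  exact ⟨(LinearIsometry.mk f.toLinearMap hf).equivRange, fun x ↦ rfl⟩

variable [IsManifold (𝓡 m) ∞ M]

lemma IsAmple.exists_isCriticalFrame (hι : IsAmple ι) (x₀ : M)
    (hn : Module.finrank ℝ E = m + n) :
    ∃ Ω, extChartAt (𝓡 m) x₀ x₀ ∈ Ω ∧ ∃ (A : ℝ^m → ℝ^m →L[ℝ] E) (B : ℝ^m → ℝ^n →L[ℝ] E),
      IsCriticalFrame ι x₀ A B Ω := by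
  set φ := extChartAt (𝓡 m) x₀
  have hopen : IsOpen φ.target := isOpen_extChartAt_target x₀
  have hsmooth : ContDiffOn ℝ ∞ (evalVector ι ∘ φ.symm) φ.target := contMDiffOn_iff_contDiffOn.1
    ((contMDiff_evalVector ι).comp_contMDiffOn (contMDiffOn_extChartAt_symm x₀))
  have hderiv : ∀ z ∈ φ.target, ⇑(fderiv ℝ (evalVector ι ∘ φ.symm) z) =
      mvfderiv (𝓡 m) (evalVector ι) (φ.symm z) ∘ chartDeriv x₀ z := fun z hz ↦
    funext (fderiv_comp_extChartAt_symm hz (mdifferentiable_evalVector ι _))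
  obtain ⟨Ω, hΩ, hx₀, A, B, hAB, hA⟩ := exists_isFramePair hopen
    (hsmooth.fderiv_of_isOpen hopen (by norm_cast)) (fun z hz ↦ by
      rw [hderiv z hz]
      exact (hι.injective_mvfderiv_evalVector _).comp (bijective_chartDeriv hz).1)
    (mem_extChartAt_target x₀) hn
  refine ⟨Ω, hx₀, A, B, hAB, hΩ, fun z hz ↦ ?_⟩
  rw [hA z hz, orthogonal_criticalSpace_eq_range]
  refine SetLike.coe_injective ?_
  rw [LinearMap.coe_range, LinearMap.coe_range]
  exact (congrArg range (hderiv z (hΩ hz))).trans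
    ((bijective_chartDeriv (hΩ hz)).2.range_comp _)

lemma IsAmple.inner_shapeOperator_section (hι : IsAmple ι) {x : M} {u : M → E}
    (hu : MDifferentiableAt (𝓡 m) 𝓘(ℝ, E) u x)
    (hmem : ∀ᶠ y in nhds x, u y ∈ (criticalSpace ι y)ᗮ) (X : TangentSpace (𝓡 m) x)
    (v : criticalSpace ι x) :
    ⟪shapeOperator ι x X ⟨u x, hmem.self_of_nhds⟩, v⟫_ℝ =
      ⟪mvfderiv (𝓡 m) u x X, (v : E)⟫_ℝ := by
  let s : ∀ y : M, (criticalSpace ι y)ᗮ := fun y ↦ (criticalSpace ι y)ᗮ.orthogonalProjectionOnto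
    (u y)
  have hs : ∀ {y}, u y ∈ (criticalSpace ι y)ᗮ → (s y : E) = u y :=
    Submodule.starProjection_eq_self_iff.2
  have hev : (fun y ↦ (s y : E)) =ᶠ[nhds x] u := hmem.mono fun y ↦ hs
  have hsx : (⟨u x, hmem.self_of_nhds⟩ : (criticalSpace ι x)ᗮ) = s x :=
    Subtype.ext (hs hmem.self_of_nhds).symm
  have hderiv : mvfderiv (𝓡 m) (fun y ↦ (s y : E)) x X = mvfderiv (𝓡 m) u x X :=
    DFunLike.congr_fun hev.mfderiv_eq X
  rw [hsx, shapeOperator_section hι x X s (hu.congr_of_eventuallyEq hev), hderiv]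
  exact Submodule.inner_orthogonalProjectionOnto_eq_of_mem_right _ _

namespace IsCriticalFrame

lemma inner_shapeOperator (h : IsCriticalFrame ι x₀ A B Ω) (hι : IsAmple ι) (hz : z ∈ Ω)
    (v : criticalSpace ι ((extChartAt (𝓡 m) x₀).symm z)) (w a : ℝ^m)
    (u : (criticalSpace ι ((extChartAt (𝓡 m) x₀).symm z))ᗮ) (hu : (u : E) = A z a) :
    ⟪shapeOperator ι ((extChartAt (𝓡 m) x₀).symm z) (chartDeriv x₀ z w) u, v⟫_ℝ =
      ⟪fderiv ℝ A z w a, (v : E)⟫_ℝ := by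
  revert v u
  set φ := extChartAt (𝓡 m) x₀
  intro v u hu
  have hzt : z ∈ φ.target := h.subset_target hz
  have hsource : φ.symm z ∈ φ.source := φ.map_target hzt
  have hφz : φ (φ.symm z) = z := φ.right_inv hzt
  have hdiff : MDifferentiableAt (𝓡 m) 𝓘(ℝ, E) (fun y ↦ A (φ y) a) (φ.symm z) := by
    refine DifferentiableAt.comp_mdifferentiableAt (g := fun y ↦ A y a) ?_
      (mdifferentiableAt_extChartAt (by rwa [extChartAt_source] at hsource))
    rw [hφz]
    exact (h.differentiableAt_left hz).clm_apply (differentiableAt_const a)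
  have hmem : ∀ᶠ y in nhds (φ.symm z), A (φ y) a ∈ (criticalSpace ι y)ᗮ := by
    have hΩ : ∀ᶠ y in nhds (φ.symm z), φ y ∈ Ω :=
      continuousAt_extChartAt' hsource (by rw [hφz]; exact h.isOpen.mem_nhds hz)
    filter_upwards [hΩ, (isOpen_extChartAt_source x₀).mem_nhds hsource] with y hy hys
    have hrange := h.range_left (φ y) hy
    rw [φ.left_inv hys] at hrange
    exact hrange ▸ ⟨a, rfl⟩
  have hcoord : (fun y ↦ A (φ y) a) ∘ φ.symm =ᶠ[nhds z] fun y ↦ A y a := by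
    filter_upwards [h.isOpen.mem_nhds hz] with y hy
    rw [Function.comp_apply, φ.right_inv (h.subset_target hy)]
  obtain rfl : u = ⟨A (φ (φ.symm z)) a, hmem.self_of_nhds⟩ := Subtype.ext (by simp only [hu, hφz])
  rw [hι.inner_shapeOperator_section hdiff hmem, ← fderiv_comp_extChartAt_symm hzt hdiff,
    hcoord.fderiv_eq, fderiv_clm_apply (h.differentiableAt_left hz) (differentiableAt_const a)]
  simp

variable [RiemannianBundle (fun x : M ↦ TangentSpace (𝓡 m) x)]

theorem volumeDensity_mul_absDetShape (h : IsCriticalFrame ι x₀ A B Ω) (hι : IsAmple ι)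
    (hz : z ∈ Ω) (v : criticalSpace ι ((extChartAt (𝓡 m) x₀).symm z)) :
    volumeDensity x₀ z * absDetShape hι ((extChartAt (𝓡 m) x₀).symm z) v =
      |(frameMatrix A z (v : E)).det| := by
  revert v
  set x := (extChartAt (𝓡 m) x₀).symm z
  intro v
  obtain ⟨L, hL⟩ := exists_linearIsometryEquiv_of_range_eq (h.norm_left z hz) (h.range_left z hz)
  let u : OrthonormalBasis (Fin m) ℝ (criticalSpace ι x)ᗮ :=
    (EuclideanSpace.basisFun (Fin m) ℝ).map L
  let e : OrthonormalBasis (Fin m) ℝ (TangentSpace (𝓡 m) x) := tangentBasis x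
  have hu : ∀ j, (u j : E) = A z (EuclideanSpace.single j 1) := fun j ↦ by
    rw [← hL, ← EuclideanSpace.basisFun_apply]
    exact congrArg Subtype.val ((EuclideanSpace.basisFun (Fin m) ℝ).map_apply L j)
  -- The matrix of the coordinate vectors in the basis `e` has determinant `± volumeDensity`.
  have hcoord : (Matrix.of fun i k ↦ ⟪coordField x₀ z i, e k⟫_ℝ) * shapeMatrix ι x e u v =
      frameMatrix A z v := by
    ext i j
    calc ∑ k, ⟪coordField x₀ z i, e k⟫_ℝ * ⟪shapeOperator ι x (e k) (u j), v⟫_ℝ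
        = ⟪shapeOperator ι x (∑ k, ⟪e k, coordField x₀ z i⟫_ℝ • e k) (u j), v⟫_ℝ := by
          simp only [map_sum, map_smul, LinearMap.sum_apply, LinearMap.smul_apply, sum_inner,
            real_inner_smul_left]
          exact Finset.sum_congr rfl fun k _ ↦ by rw [real_inner_comm]
      _ = ⟪shapeOperator ι x (chartDeriv x₀ z (EuclideanSpace.single i 1)) (u j), v⟫_ℝ := by
          rw [e.sum_repr']
          rfl
      _ = ⟪fderiv ℝ A z (EuclideanSpace.single i 1) (EuclideanSpace.single j 1), (v : E)⟫_ℝ :=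
          h.inner_shapeOperator hι hz v _ _ (u j) (hu j)
  rw [absDetShape_eq hι _ v e u, volumeDensity, sqrt_det_gram_eq_abs_det e, ← abs_mul,
    ← Matrix.det_mul, hcoord]

end IsCriticalFrame

end CriticalFrame

/-! ### The expected number of critical points -/

lemma sphereMeasure_univ_eq (F : Type*) [NormedAddCommGroup F] [InnerProductSpace ℝ F]
    [FiniteDimensional ℝ F] [MeasurableSpace F] [BorelSpace F] :
    sphereMeasure F univ = unitSphereArea (Module.finrank ℝ F) := by
  have h := (stdOrthonormalBasis ℝ F).repr.measurePreserving.measure_preimage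
    (measurableSet_ball (x := 0) (ε := 1)).nullMeasurableSet
  rw [LinearIsometryEquiv.preimage_ball, map_zero] at h
  rw [unitSphereArea, sphereMeasure, sphereMeasure, Measure.toSphere_apply_univ,
    Measure.toSphere_apply_univ, h, finrank_euclideanSpace_fin]

section CriticalCount

variable {m : ℕ} {M : Type*} [TopologicalSpace M] [ChartedSpace (ℝ^m) M]
  {E : Type*} [NormedAddCommGroup E] [InnerProductSpace ℝ E]

/-- The number of critical points of `ι v` in `A`. -/
noncomputable def numCriticalOn (ι : E →ₗ[ℝ] C^∞⟮𝓡 m, M; ℝ⟯) (A : Set M) (v : E) : ℕ∞ :=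
  {x ∈ A | v ∈ criticalSpace ι x}.encard

lemma numCriticalOn_univ (ι : E →ₗ[ℝ] C^∞⟮𝓡 m, M; ℝ⟯) (v : E) :
    numCriticalOn ι univ v = numCritical ι v := by
  simp only [numCriticalOn, numCritical, mem_univ, true_and]

lemma numCriticalOn_union (ι : E →ₗ[ℝ] C^∞⟮𝓡 m, M; ℝ⟯) {A A' : Set M} (hd : Disjoint A A')
    (v : E) : numCriticalOn ι (A ∪ A') v = numCriticalOn ι A v + numCriticalOn ι A' v := by
  have hunion : {x ∈ A ∪ A' | v ∈ criticalSpace ι x} =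
      {x ∈ A | v ∈ criticalSpace ι x} ∪ {x ∈ A' | v ∈ criticalSpace ι x} :=
    ext fun _ ↦ or_and_right
  rw [numCriticalOn, hunion, encard_union_eq (hd.mono (sep_subset _ _) (sep_subset _ _))]
  rfl

lemma numCritical_smul (ι : E →ₗ[ℝ] C^∞⟮𝓡 m, M; ℝ⟯) {r : ℝ} (hr : r ≠ 0) (v : E) :
    numCritical ι (r • v) = numCritical ι v := by
  simp only [numCritical, Submodule.smul_mem_iff _ hr]

lemma IsCriticalFrame.encard_mem_range_eq_numCriticalOn [FiniteDimensional ℝ E] {n : ℕ}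
    {ι : E →ₗ[ℝ] C^∞⟮𝓡 m, M; ℝ⟯} {x₀ : M} {A : ℝ^m → ℝ^m →L[ℝ] E} {B : ℝ^m → ℝ^n →L[ℝ] E}
    {Ω : Set (ℝ^m)} (h : IsCriticalFrame ι x₀ A B Ω) {S : Set M}
    (hS : S ⊆ (extChartAt (𝓡 m) x₀).source)
    (hSΩ : (extChartAt (𝓡 m) x₀).target ∩ (extChartAt (𝓡 m) x₀).symm ⁻¹' S ⊆ Ω) (v : E) :
    {z ∈ (extChartAt (𝓡 m) x₀).target ∩ (extChartAt (𝓡 m) x₀).symm ⁻¹' S |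
      v ∈ range (B z)}.encard = numCriticalOn ι S v := by
  set φ := extChartAt (𝓡 m) x₀
  have hmem : ∀ z ∈ φ.target ∩ φ.symm ⁻¹' S, v ∈ range (B z) ↔ v ∈ criticalSpace ι (φ.symm z) :=
    fun z hz ↦ by rw [← h.range_right (hSΩ hz)]; rfl
  rw [numCriticalOn, ← (φ.symm.injOn.mono fun z hz ↦ hz.1.1).encard_image]
  congr 1
  ext x
  constructor
  · rintro ⟨z, ⟨hz, hv⟩, rfl⟩
    exact ⟨hz.2, (hmem z hz).1 hv⟩
  · rintro ⟨hx, hv⟩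
    have hφx : φ.symm (φ x) = x := φ.left_inv (hS hx)
    have hz : φ x ∈ φ.target ∩ φ.symm ⁻¹' S :=
      ⟨φ.map_source (hS hx), by rwa [mem_preimage, hφx]⟩
    exact ⟨φ x, ⟨hz, (hmem _ hz).2 (by rwa [hφx])⟩, hφx⟩

end CriticalCount

section CriticalDensity

variable {m : ℕ} {M : Type*} [TopologicalSpace M] [ChartedSpace (ℝ^m) M]
  {E : Type*} [NormedAddCommGroup E] [InnerProductSpace ℝ E] [FiniteDimensional ℝ E]
  {ι : E →ₗ[ℝ] C^∞⟮𝓡 m, M; ℝ⟯} [RiemannianBundle (fun x : M ↦ TangentSpace (𝓡 m) x)]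

lemma absDetShape_smul (hι : IsAmple ι) (x : M) (r : ℝ) (v : criticalSpace ι x) :
    absDetShape hι x (r • v) = |r| ^ m * absDetShape hι x v := by
  have hsmul : ∀ (e : OrthonormalBasis (Fin m) ℝ (TangentSpace (𝓡 m) x))
      (u : OrthonormalBasis (Fin m) ℝ (criticalSpace ι x)ᗮ),
      shapeMatrix ι x e u (r • v) = r • shapeMatrix ι x e u v := fun e u ↦ by
    ext i j
    exact real_inner_smul_right _ _ _
  rw [absDetShape, absDetShape, hsmul, Matrix.det_smul, abs_mul, Fintype.card_fin, abs_pow]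

lemma continuous_absDetShape (hι : IsAmple ι) (x : M) : Continuous (absDetShape hι x) :=
  continuous_abs.comp <| Continuous.matrix_det <| continuous_pi fun _ ↦ continuous_pi fun _ ↦
    continuous_const.inner continuous_subtype_val

variable [MeasurableSpace E] [BorelSpace E]

/-- The integral of `|det Ξ_x · v|` over the unit ball of `K_x`. By homogeneity it is a constant
multiple of the integral over the unit sphere; unlike the latter, it is not distorted by polar
coordinates, so that the change of variables applies to it directly. -/
noncomputable def criticalDensity (hι : IsAmple ι) (x : M) : ℝ≥0∞ :=
  ∫⁻ v in ball (0 : criticalSpace ι x) 1, ENNReal.ofReal (absDetShape hι x v)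

-- The factor is `dim K_x + m`, where `m` is the degree of `|det Ξ_x · v|`.
lemma lintegral_sphere_absDetShape (hι : IsAmple ι) (x : M) :
    ∫⁻ v, ENNReal.ofReal (absDetShape hι x v) ∂(sphereMeasure (criticalSpace ι x)) =
      (Module.finrank ℝ E : ℝ≥0∞) * criticalDensity hι x := by
  rw [← hι.finrank_criticalSpace_add x]
  refine lintegral_toSphere_of_homogeneous
    (g := fun v ↦ ENNReal.ofReal (absDetShape hι x v)) (fun r hr v ↦ ?_) (fun hm ↦ ?_)
    (ENNReal.measurable_ofReal.comp (continuous_absDetShape hι x).measurable).aemeasurable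
  · rw [absDetShape_smul, abs_of_pos hr, ENNReal.ofReal_mul (pow_nonneg hr.le m)]
  · rw [← zero_smul ℝ (0 : criticalSpace ι x), absDetShape_smul, abs_zero, zero_pow hm, zero_mul,
      ENNReal.ofReal_zero]

lemma IsCriticalFrame.volumeDensity_mul_criticalDensity [IsManifold (𝓡 m) ∞ M] {x₀ : M} {n : ℕ}
    {A : ℝ^m → ℝ^m →L[ℝ] E} {B : ℝ^m → ℝ^n →L[ℝ] E} {Ω : Set (ℝ^m)}
    (h : IsCriticalFrame ι x₀ A B Ω) (hι : IsAmple ι) {z : ℝ^m} (hz : z ∈ Ω) :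
    ENNReal.ofReal (volumeDensity x₀ z) *
        criticalDensity hι ((extChartAt (𝓡 m) x₀).symm z) =
      ∫⁻ c in ball 0 1, ENNReal.ofReal |(frameMatrix A z (B z c)).det| := by
  obtain ⟨L, hL⟩ := exists_linearIsometryEquiv_of_range_eq (h.norm_right z hz) (h.range_right hz)
  have hball : L ⁻¹' ball 0 1 = ball 0 1 := by rw [L.preimage_ball, map_zero]
  rw [criticalDensity, ← L.measurePreserving.setLIntegral_comp_preimage_emb
    L.toHomeomorph.measurableEmbedding, hball, ← lintegral_const_mul' _ _ ENNReal.ofReal_ne_top]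
  refine lintegral_congr fun c ↦ ?_
  rw [← ENNReal.ofReal_mul (p := volumeDensity x₀ z) (Real.sqrt_nonneg _),
    h.volumeDensity_mul_absDetShape hι hz, hL]

end CriticalDensity

section CriticalFormula

variable {m : ℕ} {M : Type*} [TopologicalSpace M] [ChartedSpace (ℝ^m) M]
  {E : Type*} [NormedAddCommGroup E] [InnerProductSpace ℝ E] [FiniteDimensional ℝ E]
  [MeasurableSpace E] [BorelSpace E] {ι : E →ₗ[ℝ] C^∞⟮𝓡 m, M; ℝ⟯} [MeasurableSpace M]
  [RiemannianBundle (fun x : M ↦ TangentSpace (𝓡 m) x)]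

/-- The integral formula for the number of critical points in `A`, in its ball form: the parameter
`v` ranges over the unit ball of `E` instead of the unit sphere. -/
structure CriticalFormula (hι : IsAmple ι) (A : Set M) : Prop where
  aemeasurable_numCriticalOn : AEMeasurable (fun v ↦ (numCriticalOn ι A v : ℝ≥0∞))
    ((volume : Measure E).restrict (ball 0 1))
  aemeasurable_criticalDensity :
    AEMeasurable (criticalDensity hι) ((riemannianVolume m M).restrict A)
  lt_top : ∫⁻ v in ball (0 : E) 1, (numCriticalOn ι A v : ℝ≥0∞) < ⊤
  lintegral_eq : ∫⁻ v in ball (0 : E) 1, (numCriticalOn ι A v : ℝ≥0∞) =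
    ∫⁻ x in A, criticalDensity hι x ∂riemannianVolume m M

lemma criticalFormula_empty (hι : IsAmple ι) : CriticalFormula hι ∅ := by
  constructor <;> simp [numCriticalOn]

lemma CriticalFormula.union {hι : IsAmple ι} {A A' : Set M} (h : CriticalFormula hι A)
    (h' : CriticalFormula hι A') (hA' : MeasurableSet A') (hd : Disjoint A A') :
    CriticalFormula hι (A ∪ A') := by
  have hcount : (fun v ↦ (numCriticalOn ι (A ∪ A') v : ℝ≥0∞)) = fun v ↦
      (numCriticalOn ι A v : ℝ≥0∞) + (numCriticalOn ι A' v : ℝ≥0∞) := by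
    simp only [numCriticalOn_union ι hd, ENat.toENNReal_add]
  have hsum := lintegral_add_left' h.aemeasurable_numCriticalOn
    fun v ↦ (numCriticalOn ι A' v : ℝ≥0∞)
  rw [← hcount] at hsum
  refine ⟨?_, aemeasurable_union_iff.2
    ⟨h.aemeasurable_criticalDensity, h'.aemeasurable_criticalDensity⟩, ?_, ?_⟩
  · rw [hcount]
    exact h.aemeasurable_numCriticalOn.add h'.aemeasurable_numCriticalOn
  · rw [hsum]
    exact ENNReal.add_lt_top.2 ⟨h.lt_top, h'.lt_top⟩
  · rw [hsum, h.lintegral_eq, h'.lintegral_eq, lintegral_union hA' hd]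

variable [IsManifold (𝓡 m) ∞ M] [BorelSpace M]
  [IsContinuousRiemannianBundle (ℝ^m) (fun x : M ↦ TangentSpace (𝓡 m) x)]

theorem IsCriticalFrame.criticalFormula {n : ℕ} {x₀ : M} {A : ℝ^m → ℝ^m →L[ℝ] E}
    {B : ℝ^m → ℝ^n →L[ℝ] E} {Ω : Set (ℝ^m)} (h : IsCriticalFrame ι x₀ A B Ω) (hι : IsAmple ι)
    {C : Set (ℝ^m)} (hC : IsCompact C) (hCΩ : C ⊆ Ω) {S : Set M} (hSm : MeasurableSet S)
    (hS : S ⊆ (extChartAt (𝓡 m) x₀).source ∩ extChartAt (𝓡 m) x₀ ⁻¹' C) :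
    CriticalFormula hι S := by
  set φ := extChartAt (𝓡 m) x₀
  set s := φ.target ∩ φ.symm ⁻¹' S
  have hS₀ : S ⊆ φ.source := hS.trans inter_subset_left
  have hsm : MeasurableSet s := measurableSet_target_inter_preimage x₀ hSm
  have hsC : s ⊆ C := fun z hz ↦ by simpa only [mem_preimage, φ.right_inv hz.1] using (hS hz.2).2
  have hsΩ : s ⊆ Ω := hsC.trans hCΩ
  have hcount : (fun v ↦ ({z ∈ s | v ∈ range (B z)}.encard : ℝ≥0∞)) =
      fun v ↦ (numCriticalOn ι S v : ℝ≥0∞) :=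
    funext fun v ↦ congrArg _ (h.encard_mem_range_eq_numCriticalOn hS₀ hsΩ v)
  have hlint := h.lintegral_encard hsm hsΩ
  have hmeas := h.aemeasurable_encard hsm hsΩ
  rw [hcount] at hlint hmeas
  have hdens : ∀ z ∈ s, ENNReal.ofReal (volumeDensity x₀ z) * criticalDensity hι (φ.symm z) =
      ∫⁻ c in ball 0 1, ENNReal.ofReal |(frameMatrix A z (B z c)).det| :=
    fun z hz ↦ h.volumeDensity_mul_criticalDensity hι (hsΩ hz)
  have hcoord : AEMeasurable (fun z ↦ criticalDensity hι (φ.symm z)) (volume.restrict s) :=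
    aemeasurable_comp_symm_of_volumeDensity_mul hSm
      ((h.aemeasurable_det_frameMatrix hsm hsΩ).lintegral_prod_right'.congr
        ((ae_restrict_of_forall_mem hsm hdens).mono fun _ ↦ Eq.symm))
  refine ⟨hmeas, aemeasurable_riemannianVolume_of_comp_symm hSm hS₀ hcoord, ?_, ?_⟩
  · rw [hlint]
    exact (lintegral_mono_set hsC).trans_lt (h.lintegral_det_frameMatrix_lt_top hC hCΩ)
  · rw [hlint, setLIntegral_riemannianVolume hSm hS₀ hcoord]
    exact (setLIntegral_congr_fun hsm hdens).symm

lemma IsAmple.exists_nhds_criticalFormula (hι : IsAmple ι) (x₀ : M) :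
    ∃ W ∈ nhds x₀, IsOpen W ∧ ∀ A ⊆ W, MeasurableSet A → CriticalFormula hι A := by
  obtain ⟨Ω, hx₀, A, B, h⟩ := hι.exists_isCriticalFrame x₀
    (((add_comm _ _).trans (hι.finrank_criticalSpace_add x₀)).symm)
  obtain ⟨r, hr, hrΩ⟩ := nhds_basis_closedBall.mem_iff.1 (h.isOpen.mem_nhds hx₀)
  have hW := (continuousOn_extChartAt (I := 𝓡 m) x₀).isOpen_inter_preimage
    (isOpen_extChartAt_source x₀) (isOpen_ball (x := extChartAt (𝓡 m) x₀ x₀) (ε := r))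
  refine ⟨_, hW.mem_nhds ⟨mem_extChartAt_source x₀, mem_ball_self hr⟩, hW, fun S hS hSm ↦ ?_⟩
  exact h.criticalFormula hι (isCompact_closedBall _ _) hrΩ hSm
    (hS.trans (inter_subset_inter_right _ (preimage_mono ball_subset_closedBall)))

lemma IsAmple.criticalFormula_univ [CompactSpace M] (hι : IsAmple ι) :
    CriticalFormula hι univ := by
  suffices h : ∃ S : Set M, univ ⊆ S ∧ MeasurableSet S ∧
      ∀ A ⊆ S, MeasurableSet A → CriticalFormula hι A by
    obtain ⟨S, hS, -, h⟩ := h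
    exact h univ hS MeasurableSet.univ
  refine isCompact_univ.induction_on ?he ?hmono ?hunion ?hnhds
  case he =>
    refine ⟨∅, subset_rfl, MeasurableSet.empty, fun A hA _ ↦ ?_⟩
    rw [subset_empty_iff.1 hA]
    exact criticalFormula_empty hι
  case hmono =>
    rintro T T' hT ⟨S, hS, h⟩
    exact ⟨S, hT.trans hS, h⟩
  case hunion =>
    rintro T T' ⟨S, hS, hSm, h⟩ ⟨S', hS', hSm', h'⟩
    refine ⟨S ∪ S', union_subset_union hS hS', hSm.union hSm', fun A hA hAm ↦ ?_⟩
    rw [← inter_union_sdiff A S]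
    exact (h _ inter_subset_right (hAm.inter hSm)).union
      (h' _ (fun x hx ↦ (hA hx.1).resolve_left hx.2) (hAm.diff hSm)) (hAm.diff hSm)
      disjoint_sdiff_inter.symm
  case hnhds =>
    intro x _
    obtain ⟨W, hxW, hW, h⟩ := hι.exists_nhds_criticalFormula x
    exact ⟨W, mem_nhdsWithin_of_mem_nhds hxW, W, subset_rfl, hW.measurableSet, h⟩

variable [CompactSpace M]

lemma IsAmple.aemeasurable_sphere_numCritical (hι : IsAmple ι) :
    AEMeasurable (fun v : sphere (0 : E) 1 ↦ (numCritical ι (v : E) : ℝ≥0∞)) (sphereMeasure E) :=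
  aemeasurable_toSphere_of_homogeneous (k := 0) (g := fun v ↦ (numCritical ι v : ℝ≥0∞))
    (fun r hr v ↦ by simp [numCritical_smul ι hr.ne'])
    (by simpa only [numCriticalOn_univ] using hι.criticalFormula_univ.aemeasurable_numCriticalOn)

lemma lintegral_sphere_numCritical (hι : IsAmple ι) :
    ∫⁻ v : sphere (0 : E) 1, (numCritical ι (v : E) : ℝ≥0∞) ∂(sphereMeasure E) =
      (Module.finrank ℝ E : ℝ≥0∞) * ∫⁻ v in ball (0 : E) 1, (numCriticalOn ι univ v : ℝ≥0∞) := by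
  simp only [← numCriticalOn_univ]
  refine lintegral_toSphere_of_homogeneous (k := 0)
    (g := fun v ↦ (numCriticalOn ι univ v : ℝ≥0∞)) (fun r hr v ↦ ?_) (fun h ↦ absurd rfl h)
    hι.criticalFormula_univ.aemeasurable_numCriticalOn
  simp [numCriticalOn_univ, numCritical_smul ι hr.ne']

lemma IsAmple.expectedCritical_lt_top (hι : IsAmple ι) : expectedCritical ι < ⊤ := by
  rw [expectedCritical, lintegral_sphere_numCritical hι]
  rcases subsingleton_or_nontrivial E with hE | hE
  · simp [Module.finrank_zero_of_subsingleton]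
  · have hpos : 0 < sphereMeasure E univ :=
      Measure.measure_univ_pos.2 (Measure.toSphere_ne_zero volume)
    exact ENNReal.mul_lt_top (ENNReal.inv_lt_top.2 hpos)
      (ENNReal.mul_lt_top (ENNReal.natCast_lt_top _) hι.criticalFormula_univ.lt_top)

theorem theorem1p1_general (hι : IsAmple ι) :
    AEMeasurable (fun v : sphere (0 : E) 1 ↦ (numCritical ι (v : E) : ℝ≥0∞)) (sphereMeasure E) ∧
    AEMeasurable (fun x : M ↦ ∫⁻ v, ENNReal.ofReal (absDetShape hι x v)
      ∂(sphereMeasure (criticalSpace ι x))) (riemannianVolume m M) ∧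
    expectedCritical ι < ⊤ ∧
    expectedCritical ι = (unitSphereArea (Module.finrank ℝ E))⁻¹ *
      ∫⁻ x, (∫⁻ v, ENNReal.ofReal (absDetShape hι x v)
        ∂(sphereMeasure (criticalSpace ι x))) ∂(riemannianVolume m M) := by
  have hformula := hι.criticalFormula_univ
  have hdens : AEMeasurable (criticalDensity hι) (riemannianVolume m M) := by
    simpa only [Measure.restrict_univ] using hformula.aemeasurable_criticalDensity
  simp only [lintegral_sphere_absDetShape]
  refine ⟨hι.aemeasurable_sphere_numCritical, hdens.const_mul _, hι.expectedCritical_lt_top, ?_⟩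
  calc expectedCritical ι
      = (unitSphereArea (Module.finrank ℝ E))⁻¹ * ((Module.finrank ℝ E : ℝ≥0∞) *
          ∫⁻ v in ball (0 : E) 1, (numCriticalOn ι univ v : ℝ≥0∞)) := by
        rw [expectedCritical, lintegral_sphere_numCritical hι, sphereMeasure_univ_eq]
    _ = (unitSphereArea (Module.finrank ℝ E))⁻¹ *
          ∫⁻ x, (Module.finrank ℝ E : ℝ≥0∞) * criticalDensity hι x ∂riemannianVolume m M := by
        rw [hformula.lintegral_eq, setLIntegral_univ, lintegral_const_mul'' _ hdens]

end CriticalFormula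

theorem theorem1p1 {m : ℕ} {M : Type*} [TopologicalSpace M]
    [ChartedSpace (EuclideanSpace ℝ (Fin m)) M] [IsManifold (𝓡 m) ∞ M]
    [T2Space M] [CompactSpace M] [ConnectedSpace M] [MeasurableSpace M] [BorelSpace M]
    [RiemannianBundle (fun x : M ↦ TangentSpace (𝓡 m) x)]
    [IsContMDiffRiemannianBundle (𝓡 m) ∞ (EuclideanSpace ℝ (Fin m))
      (fun x : M ↦ TangentSpace (𝓡 m) x)]
    (V : Submodule ℝ C^∞⟮𝓡 m, M; ℝ⟯) [FiniteDimensional ℝ V] (h : InnerProductSpace.Core ℝ V)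
    (hV : IsAmple (SampleSpace.incl V h)) :
    AEMeasurable
      (fun v : sphere (0 : SampleSpace V h) 1 ↦
        (numCritical (SampleSpace.incl V h) (v : SampleSpace V h) : ℝ≥0∞))
      (sphereMeasure (SampleSpace V h)) ∧
    AEMeasurable
      (fun x : M ↦ ∫⁻ v, ENNReal.ofReal (absDetShape hV x v)
        ∂(sphereMeasure (criticalSpace (SampleSpace.incl V h) x)))
      (riemannianVolume m M) ∧
    expectedCritical (SampleSpace.incl V h) < ⊤ ∧
    expectedCritical (SampleSpace.incl V h) =
      (unitSphereArea (Module.finrank ℝ V))⁻¹ *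
        ∫⁻ x, (∫⁻ v, ENNReal.ofReal (absDetShape hV x v)
          ∂(sphereMeasure (criticalSpace (SampleSpace.incl V h) x))) ∂(riemannianVolume m M) := by
  have : IsContinuousRiemannianBundle (EuclideanSpace ℝ (Fin m))
      (fun x : M ↦ TangentSpace (𝓡 m) x) := by
    obtain ⟨g, hg, h⟩ := IsContMDiffRiemannianBundle.exists_contMDiff (IB := 𝓡 m) (n := ∞)
      (F := EuclideanSpace ℝ (Fin m)) (E := fun x : M ↦ TangentSpace (𝓡 m) x)
    exact ⟨g, hg.continuous, h⟩
  exact theorem1p1_general hV
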